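/- **Theorem 1.3.** Let $R$ be a commutative artinian ring, let $A$ and $B$ be $R$-algebras that are finitely generated as $R$-modules, and let ${}_AN_B$ and ${}_BM_A$ be bimodules on which $R$ acts centrally and which are finitely generated over $R$. Let $\phi: M\otimes_AN\to B$ and $\psi: N\otimes_BM\to A$ be bimodule homomorphisms with $\phi(m\otimes n)m'=m\,\psi(n\otimes m')$ and $n\,\phi(m\otimes n')=\psi(n\otimes m)n'$ for all $m,m'\in M$, $n,n'\in N$, and let $$\Lambda=\Lambda_{(\phi,\psi)}=\begin{pmatrix}A&N\\M&B\end{pmatrix}$$ be the corresponding Morita ring, with multiplication $$\begin{pmatrix}a&n\\m&b\end{pmatrix}\begin{pmatrix}a'&n'\\m'&b'\end{pmatrix}=\begin{pmatrix}aa'+\psi(n\otimes m')&an'+nb'\\ma'+bm'&bb'+\phi(m\otimes n')\end{pmatrix}.$$ Assume that $M\otimes_AN=0=N\otimes_BM$ (so $\phi=0=\psi$) and that ${}_BM$, ${}_AN$, $M_A$ and $N_B$ are projective modules. Let $X$ be a finitely generated left $A$-module, $Y$ a finitely generated left $B$-module, $f: M\otimes_AX\to Y$ a $B$-homomorphism and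 $g: N\otimes_BY\to X$ an $A$-homomorphism. Let $\begin{pmatrix}X\\Y\end{pmatrix}_{f,g}$ be the left $\Lambda$-module $X\oplus Y$ with action $$\begin{pmatrix}a&n\\m&b\end{pmatrix}\begin{pmatrix}x\\y\end{pmatrix}=\begin{pmatrix}ax+g(n\otimes y)\\f(m\otimes x)+by\end{pmatrix}.$$ Then $\begin{pmatrix}X\\Y\end{pmatrix}_{f,g}$ is semi-Gorenstein-projective, that is, $\mathrm{Ext}^i_\Lambda\Big(\begin{pmatrix}X\\Y\end{pmatrix}_{f,g},\Lambda\Big)=0$ for all $i\ge1$, if and only if the following four conditions hold: 1. $\mathrm{Hom}_A(g,A):\mathrm{Hom}_A(X,A)\to\mathrm{Hom}_A(N\otimes_BY,A)$ is an epimorphism; 2. $\mathrm{Ext}^i_A(g,A):\mathrm{Ext}^i_A(X,A)\to\mathrm{Ext}^i_A(N\otimes_BY,A)$ is an isomorphism for all $i\ge1$; 3. $\mathrm{Hom}_B(f,B):\mathrm{Hom}_B(Y,B)\to\mathrm{Hom}_B(M\otimes_AX,B)$ is an epimorphism; 4. $\mathrm{Ext}^i_B(f,B):\mathrm{Ext}^i_B(Y,B)\to\mathrm{Ext}^i_B(M\otimes_AX,B)$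 is an isomorphism for all $i\ge1$. -/

import Mathlib

open scoped TensorProduct
open MulOpposite

noncomputable section

/-! ### The tensor product of bimodules over a noncommutative ring

Right `A`-modules are modules over `Aᵐᵒᵖ`; a `B`-`A`-bimodule is an abelian group with commuting
actions of `B` and `Aᵐᵒᵖ`. -/

section Tensor

universe u
variable (B A M X : Type u) [Ring B] [Ring A] [AddCommGroup M] [Module B M] [Module Aᵐᵒᵖ M]
  [SMulCommClass B Aᵐᵒᵖ M] [AddCommGroup X] [Module A X]

/-- The subgroup of `M ⊗[ℤ] X` generated by all `m a ⊗ x - m ⊗ a x`; it is stable under the left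
action of `B` on `M`. -/
def balancedRel : Submodule B (M ⊗[ℤ] X) where
  __ := AddSubgroup.closure
    {t : M ⊗[ℤ] X | ∃ (m : M) (a : A) (x : X), t = (op a • m) ⊗ₜ[ℤ] x - m ⊗ₜ[ℤ] (a • x)}
  smul_mem' b t ht := by
    change b • t ∈ AddSubgroup.closure _
    change t ∈ AddSubgroup.closure _ at ht
    induction ht using AddSubgroup.closure_induction with
    | mem t h =>
      obtain ⟨m, a, x, rfl⟩ := h
      refine AddSubgroup.subset_closure ⟨b • m, a, x, ?_⟩
      rw [smul_sub, TensorProduct.smul_tmul', TensorProduct.smul_tmul', smul_comm]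
    | zero => rw [smul_zero]; exact zero_mem _
    | add s t _ _ hs ht => rw [smul_add]; exact add_mem hs ht
    | neg t _ ht => rw [smul_neg]; exact neg_mem ht

/-- The tensor product `M ⊗_A X` of a `B`-`A`-bimodule `M` and a left `A`-module `X`, with its
structure of a left `B`-module. -/
abbrev BimodTensor : Type u := (M ⊗[ℤ] X) ⧸ balancedRel B A M X

namespace BimodTensor

variable {M X}

/-- The element `m ⊗ x` of `M ⊗_A X`. -/
def tmul (m : M) (x : X) : BimodTensor B A M X := (balancedRel B A M X).mkQ (m ⊗ₜ[ℤ] x)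

lemma add_tmul (m m' : M) (x : X) :
    tmul B A (m + m') x = tmul B A m x + tmul B A m' x := by
  simp only [tmul, TensorProduct.add_tmul, map_add]

lemma tmul_add (m : M) (x x' : X) :
    tmul B A m (x + x') = tmul B A m x + tmul B A m x' := by
  simp only [tmul, TensorProduct.tmul_add, map_add]

lemma zero_tmul (x : X) : tmul B A (0 : M) x = 0 := by
  simp only [tmul, TensorProduct.zero_tmul, map_zero]

lemma tmul_zero (m : M) : tmul B A m (0 : X) = 0 := by
  simp only [tmul, TensorProduct.tmul_zero, map_zero]

lemma smul_tmul' (b : B) (m : M) (x : X) : b • tmul B A m x = tmul B A (b • m) x := by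
  rw [tmul, tmul, ← map_smul, TensorProduct.smul_tmul']

lemma op_smul_tmul (m : M) (a : A) (x : X) : tmul B A (op a • m) x = tmul B A m (a • x) := by
  rw [tmul, tmul, ← sub_eq_zero, ← map_sub, Submodule.mkQ_apply, Submodule.Quotient.mk_eq_zero]
  exact AddSubgroup.subset_closure ⟨m, a, x, rfl⟩

/-- A biadditive `A`-balanced map vanishes if `M ⊗_A X` does. -/
lemma eq_zero_of_subsingleton {P : Type*} [AddCommGroup P] [Subsingleton (BimodTensor B A M X)]
    (h : M →+ X →+ P) (hbal : ∀ m (a : A) x, h (op a • m) x = h m (a • x)) (m : M) (x : X) :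
    h m x = 0 := by
  let h' : M ⊗[ℤ] X →+ P :=
    TensorProduct.liftAddHom h (fun r m x => by simp)
  have hle : ∀ t ∈ balancedRel B A M X, h' t = 0 := by
    intro t ht
    change t ∈ AddSubgroup.closure _ at ht
    refine (AddSubgroup.closure_le (K := h'.ker)).2 ?_ ht
    rintro _ ⟨m, a, x, rfl⟩
    change h' _ = 0
    rw [map_sub, sub_eq_zero]
    exact hbal m a x
  exact hle (m ⊗ₜ[ℤ] x)
    ((Submodule.Quotient.mk_eq_zero _).1 (Subsingleton.elim (tmul B A m x) 0))

end BimodTensor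

end Tensor

open BimodTensor

/-! ### Morita rings -/

section Morita

universe u

/-- The bimodule homomorphisms `φ : M ⊗_A N → B` and `ψ : N ⊗_B M → A` defining a Morita ring,
with the compatibilities that make it associative. Here `M` is a `B`-`A`-bimodule and `N` is an
`A`-`B`-bimodule. -/
structure MoritaDatum (A B M N : Type u) [Ring A] [Ring B]
    [AddCommGroup M] [Module B M] [Module Aᵐᵒᵖ M] [SMulCommClass B Aᵐᵒᵖ M]
    [AddCommGroup N] [Module A N] [Module Bᵐᵒᵖ N] [SMulCommClass A Bᵐᵒᵖ N] where
  /-- the map `φ`, linear over `B` on the left -/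
  φ : BimodTensor B A M N →ₗ[B] B
  /-- `φ` is linear over `B` on the right -/
  φ_right : ∀ (m : M) (n : N) (b : B), φ (tmul B A m (op b • n)) = φ (tmul B A m n) * b
  /-- the map `ψ`, linear over `A` on the left -/
  ψ : BimodTensor A B N M →ₗ[A] A
  /-- `ψ` is linear over `A` on the right -/
  ψ_right : ∀ (n : N) (m : M) (a : A), ψ (tmul A B n (op a • m)) = ψ (tmul A B n m) * a
  /-- `φ(m ⊗ n) m' = m ψ(n ⊗ m')` -/
  φ_smul : ∀ (m m' : M) (n : N), φ (tmul B A m n) • m' = op (ψ (tmul A B n m')) • m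
  /-- `n φ(m ⊗ n') = ψ(n ⊗ m) n'` -/
  ψ_smul : ∀ (n n' : N) (m : M), op (φ (tmul B A m n')) • n = ψ (tmul A B n m) • n'

variable {A B M N : Type u} [Ring A] [Ring B]
  [AddCommGroup M] [Module B M] [Module Aᵐᵒᵖ M] [SMulCommClass B Aᵐᵒᵖ M]
  [AddCommGroup N] [Module A N] [Module Bᵐᵒᵖ N] [SMulCommClass A Bᵐᵒᵖ N]

/-- The Morita ring of matrices `(a, n; m, b)`. -/
@[ext] structure MoritaRing (D : MoritaDatum A B M N) : Type u where
  /-- upper left entry -/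
  a : A
  /-- upper right entry -/
  n : N
  /-- lower left entry -/
  m : M
  /-- lower right entry -/
  b : B

namespace MoritaRing

variable {D : MoritaDatum A B M N}

instance : Zero (MoritaRing D) := ⟨⟨0, 0, 0, 0⟩⟩
instance : One (MoritaRing D) := ⟨⟨1, 0, 0, 1⟩⟩
instance : Add (MoritaRing D) := ⟨fun s t => ⟨s.a + t.a, s.n + t.n, s.m + t.m, s.b + t.b⟩⟩
instance : Neg (MoritaRing D) := ⟨fun s => ⟨-s.a, -s.n, -s.m, -s.b⟩⟩

/-- Matrix multiplication; `a n' + n b'` and `m a' + b m'` use the bimodule structures. -/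
instance : Mul (MoritaRing D) := ⟨fun s t =>
  ⟨s.a * t.a + D.ψ (tmul A B s.n t.m), s.a • t.n + op t.b • s.n,
   op t.a • s.m + s.b • t.m, s.b * t.b + D.φ (tmul B A s.m t.n)⟩⟩

@[simp] lemma zero_a : (0 : MoritaRing D).a = 0 := rfl
@[simp] lemma zero_n : (0 : MoritaRing D).n = 0 := rfl
@[simp] lemma zero_m : (0 : MoritaRing D).m = 0 := rfl
@[simp] lemma zero_b : (0 : MoritaRing D).b = 0 := rfl
@[simp] lemma one_a : (1 : MoritaRing D).a = 1 := rfl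
@[simp] lemma one_n : (1 : MoritaRing D).n = 0 := rfl
@[simp] lemma one_m : (1 : MoritaRing D).m = 0 := rfl
@[simp] lemma one_b : (1 : MoritaRing D).b = 1 := rfl
@[simp] lemma add_a (s t : MoritaRing D) : (s + t).a = s.a + t.a := rfl
@[simp] lemma add_n (s t : MoritaRing D) : (s + t).n = s.n + t.n := rfl
@[simp] lemma add_m (s t : MoritaRing D) : (s + t).m = s.m + t.m := rfl
@[simp] lemma add_b (s t : MoritaRing D) : (s + t).b = s.b + t.b := rfl
@[simp] lemma neg_a (s : MoritaRing D) : (-s).a = -s.a := rfl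
@[simp] lemma neg_n (s : MoritaRing D) : (-s).n = -s.n := rfl
@[simp] lemma neg_m (s : MoritaRing D) : (-s).m = -s.m := rfl
@[simp] lemma neg_b (s : MoritaRing D) : (-s).b = -s.b := rfl
@[simp] lemma mul_a (s t : MoritaRing D) :
    (s * t).a = s.a * t.a + D.ψ (tmul A B s.n t.m) := rfl
@[simp] lemma mul_n (s t : MoritaRing D) : (s * t).n = s.a • t.n + op t.b • s.n := rfl
@[simp] lemma mul_m (s t : MoritaRing D) : (s * t).m = op t.a • s.m + s.b • t.m := rfl
@[simp] lemma mul_b (s t : MoritaRing D) :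
    (s * t).b = s.b * t.b + D.φ (tmul B A s.m t.n) := rfl

instance : AddCommGroup (MoritaRing D) where
  add_assoc s t r := by ext <;> simp [add_assoc]
  zero_add s := by ext <;> simp
  add_zero s := by ext <;> simp
  nsmul := nsmulRec
  zsmul := zsmulRec
  neg_add_cancel s := by ext <;> simp
  add_comm s t := by ext <;> simp [add_comm]

instance : Ring (MoritaRing D) where
  __ := (inferInstance : AddCommGroup (MoritaRing D))
  left_distrib s t r := by
    ext <;> simp [mul_add, tmul_add, add_smul] <;> abel
  right_distrib s t r := by
    ext <;> simp [add_mul, add_tmul, add_smul] <;> abel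
  zero_mul s := by ext <;> simp [zero_tmul]
  mul_zero s := by ext <;> simp [tmul_zero]
  one_mul s := by ext <;> simp [zero_tmul]
  mul_one s := by ext <;> simp [tmul_zero]
  mul_assoc s t r := by
    ext
    · simp only [mul_a, mul_n, mul_m, add_mul, mul_add, add_tmul, tmul_add, map_add, D.ψ_right,
        ← smul_tmul', map_smul, smul_eq_mul, op_smul_tmul, mul_assoc]
      abel
    · simp only [mul_a, mul_n, mul_b, add_smul, smul_add, mul_smul, op_add, op_mul, D.ψ_smul,
        smul_comm]
      abel
    · simp only [mul_a, mul_m, mul_b, add_smul, smul_add, mul_smul, op_add, op_mul, D.φ_smul,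
        smul_comm]
      abel
    · simp only [mul_b, mul_n, mul_m, add_mul, mul_add, add_tmul, tmul_add, map_add, D.φ_right,
        ← smul_tmul', map_smul, smul_eq_mul, op_smul_tmul, mul_assoc]
      abel

end MoritaRing

/-! ### Modules over Morita rings -/

variable (X Y : Type u) [AddCommGroup X] [Module A X] [AddCommGroup Y] [Module B Y]

/-- A quadruple `(X, Y, f, g)`, that is, a left module over the Morita ring. -/
structure MoritaQuad (D : MoritaDatum A B M N) where
  /-- the map `f : M ⊗_A X → Y` -/
  f : BimodTensor B A M X →ₗ[B] Y
  /-- the map `g : N ⊗_B Y → X` -/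
  g : BimodTensor A B N Y →ₗ[A] X
  /-- `g(n ⊗ f(m ⊗ x)) = ψ(n ⊗ m) x` -/
  g_f : ∀ (n : N) (m : M) (x : X),
    g (tmul A B n (f (tmul B A m x))) = D.ψ (tmul A B n m) • x
  /-- `f(m ⊗ g(n ⊗ y)) = φ(m ⊗ n) y` -/
  f_g : ∀ (m : M) (n : N) (y : Y),
    f (tmul B A m (g (tmul A B n y))) = D.φ (tmul B A m n) • y

variable {X Y}

/-- If `M ⊗_A N = 0`, then `f(m ⊗ g(n ⊗ y)) = 0` for all `A`-linear `g` and `B`-linear `f`. -/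
lemma comp_eq_zero_of_subsingleton (h : Subsingleton (BimodTensor B A M N))
    (f : BimodTensor B A M X →ₗ[B] Y) (g : BimodTensor A B N Y →ₗ[A] X) (m : M) (n : N) (y : Y) :
    f (tmul B A m (g (tmul A B n y))) = 0 :=
  eq_zero_of_subsingleton B A
    (AddMonoidHom.mk' (fun m => AddMonoidHom.mk' (fun n => f (tmul B A m (g (tmul A B n y))))
      (fun n n' => by rw [add_tmul, map_add, tmul_add, map_add]))
      (fun m m' => by ext n; simp [add_tmul]))
    (fun m a n => by simp [op_smul_tmul, ← smul_tmul']) m n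

namespace MoritaQuad

/-- If `M ⊗_A N = 0 = N ⊗_B M`, then any two maps `f`, `g` form a quadruple. -/
def ofMaps (D : MoritaDatum A B M N) (hMN : Subsingleton (BimodTensor B A M N))
    (hNM : Subsingleton (BimodTensor A B N M))
    (f : BimodTensor B A M X →ₗ[B] Y) (g : BimodTensor A B N Y →ₗ[A] X) :
    MoritaQuad X Y D where
  f := f
  g := g
  g_f n m x := by
    rw [comp_eq_zero_of_subsingleton hNM g f, Subsingleton.elim (tmul A B n m) 0, map_zero,
      zero_smul]
  f_g m n y := by
    rw [comp_eq_zero_of_subsingleton hMN f g, Subsingleton.elim (tmul B A m n) 0, map_zero,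
      zero_smul]

variable {D : MoritaDatum A B M N}

/-- The left module over the Morita ring given by a quadruple: column vectors `(x; y)`. -/
@[nolint unusedArguments]
def Carrier (_Q : MoritaQuad X Y D) : Type u := X × Y

instance (Q : MoritaQuad X Y D) : AddCommGroup Q.Carrier := inferInstanceAs (AddCommGroup (X × Y))

/-- The action is the multiplication of a matrix and a column vector:
`(a, n; m, b) (x; y) = (a x + g(n ⊗ y); f(m ⊗ x) + b y)`. -/
instance (Q : MoritaQuad X Y D) : Module (MoritaRing D) Q.Carrier where
  smul s v := ((s.a • v.1 + Q.g (tmul A B s.n v.2), Q.f (tmul B A s.m v.1) + s.b • v.2) : X × Y)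
  one_smul v := by
    change ((_, _) : X × Y) = v
    ext <;> simp [zero_tmul]
  mul_smul s t v := by
    change ((_, _) : X × Y) = (s.a • (t.a • v.1 + Q.g (tmul A B t.n v.2))
      + Q.g (tmul A B s.n (Q.f (tmul B A t.m v.1) + t.b • v.2)),
      Q.f (tmul B A s.m (t.a • v.1 + Q.g (tmul A B t.n v.2)))
      + s.b • (Q.f (tmul B A t.m v.1) + t.b • v.2))
    ext
    · simp only [MoritaRing.mul_a, MoritaRing.mul_n, add_smul, smul_add, mul_smul, add_tmul,
        tmul_add, map_add, Q.g_f, op_smul_tmul, ← smul_tmul', map_smul]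
      abel
    · simp only [MoritaRing.mul_m, MoritaRing.mul_b, add_smul, smul_add, mul_smul, add_tmul,
        tmul_add, map_add, Q.f_g, op_smul_tmul, ← smul_tmul', map_smul]
      abel
  smul_zero s := by
    change ((s.a • (0 : X) + Q.g (tmul A B s.n (0 : Y)),
      Q.f (tmul B A s.m (0 : X)) + s.b • (0 : Y)) : X × Y) = 0
    ext <;> simp [tmul_zero]
  smul_add s v w := by
    change ((s.a • (v.1 + w.1) + Q.g (tmul A B s.n (v.2 + w.2)),
      Q.f (tmul B A s.m (v.1 + w.1)) + s.b • (v.2 + w.2)) : X × Y) =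
      (s.a • v.1 + Q.g (tmul A B s.n v.2) + (s.a • w.1 + Q.g (tmul A B s.n w.2)),
        Q.f (tmul B A s.m v.1) + s.b • v.2 + (Q.f (tmul B A s.m w.1) + s.b • w.2))
    ext
    · simp only [smul_add, tmul_add, map_add]; abel
    · simp only [smul_add, tmul_add, map_add]; abel
  add_smul s t v := by
    change (((s + t).a • v.1 + Q.g (tmul A B (s + t).n v.2),
      Q.f (tmul B A (s + t).m v.1) + (s + t).b • v.2) : X × Y) =
      (s.a • v.1 + Q.g (tmul A B s.n v.2) + (t.a • v.1 + Q.g (tmul A B t.n v.2)),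
        Q.f (tmul B A s.m v.1) + s.b • v.2 + (Q.f (tmul B A t.m v.1) + t.b • v.2))
    ext
    · simp only [MoritaRing.add_a, MoritaRing.add_n, add_smul, add_tmul, map_add]; abel
    · simp only [MoritaRing.add_m, MoritaRing.add_b, add_smul, add_tmul, map_add]; abel
  zero_smul v := by
    change (((0 : A) • v.1 + Q.g (tmul A B (0 : N) v.2),
      Q.f (tmul B A (0 : M) v.1) + (0 : B) • v.2) : X × Y) = 0
    ext <;> simp [zero_tmul]

end MoritaQuad

end Morita

/-! ### Ext groups and semi-Gorenstein-projective modules -/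

section Ext

open CategoryTheory CategoryTheory.Abelian

universe u

/-- `Ext^i_R(M, N)`, in the category of all left `R`-modules. -/
abbrev ModExt (R : Type u) [Ring R] (M N : Type u) [AddCommGroup M] [Module R M]
    [AddCommGroup N] [Module R N] (i : ℕ) : Type u :=
  Ext (ModuleCat.of R M) (ModuleCat.of R N) i

/-- The map `Ext^i_R(h, N) : Ext^i_R(M', N) → Ext^i_R(M, N)` induced by `h : M → M'`. -/
def modExtMap {R : Type u} [Ring R] {M M' : Type u} [AddCommGroup M] [Module R M]
    [AddCommGroup M'] [Module R M'] (h : M →ₗ[R] M') (N : Type u) [AddCommGroup N] [Module R N]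
    (i : ℕ) : ModExt R M' N i →+ ModExt R M N i :=
  (Ext.mk₀ (ModuleCat.ofHom h)).precomp (ModuleCat.of R N) (zero_add i)

/-- `M` is semi-Gorenstein-projective if `Ext^i_R(M, R) = 0` for all `i ≥ 1`. -/
def IsSemiGorensteinProjective (R : Type u) [Ring R] (M : Type u) [AddCommGroup M]
    [Module R M] : Prop :=
  ∀ i : ℕ, 1 ≤ i → Subsingleton (ModExt R M R i)

end Ext

end

universe u w

/-! ### Semi-Gorenstein-projective modules over Morita rings

If `M ⊗_A N = 0 = N ⊗_B M`, then every module `(X; Y)` over the Morita ring `Λ` has a resolution of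
length one by modules `Λe ⊗ -` induced from the diagonal entries, and `Λ` is an extension of the
module `A ⊕ B` by the module `N ⊕ M`, on both of which `Λ` acts through `A × B`. The groups `Ext` from
induced modules to modules of the second kind are computed over `A` and `B`. -/

/-! Let T_A X = (X; M ⊗_A X) and T_B Y = (Y; N ⊗_B Y) be the functors `colFunctor` of the two
columns of Λ, with the diagonal entry written first. They are exact, because M_A and N_B are
projective, and they preserve projective objects. Since M ⊗_A N ⊗_B Y = 0 = N ⊗_B M ⊗_A X, there is
a short exact sequence 0 → T_A(N ⊗_B Y) ⊕ T_B(M ⊗_A X) → T_A X ⊕ T_B Y → (X; Y) → 0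
(`presentation_shortExact`). Let u be its first map. By the long exact sequence, Ext^i((X; Y), Λ) =
0 for all i ≥ 1 exactly when u induces on Ext^i(-, Λ) an epimorphism for i = 0 and isomorphisms for
i ≥ 1. This is `IsExtEquivalence u Λ`. The coefficients Λ are then replaced by A ⊕ B, using 0 → N ⊕
M → Λ → A ⊕ B → 0. Maps from columns to A ⊕ B lift to Λ, since the diagonal matrices give a section
compatible with the diagonal entries of each column. Hence Ext^i(-, Λ) → Ext^i(-, A ⊕ B) is onto at
every column and the connecting maps vanish. As N and M are direct summands of some A^n and B^m,
surjectivity or injectivity of u on Ext^i(-, A ⊕ B) passes to Ext^i(-, N ⊕ M). A diagram chase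
(`isExtEquivalence_iff_of_shortExact`) shows that Λ and A ⊕ B give equivalent conditions. Finally
Ext_Λ(T_A X, V) = Ext_A(X, V) and Ext_Λ(T_B Y, V) = 0 for an A-module V, and symmetrically for B.
Both follow by dimension shifting from the case of Hom (`extMapOfNatTrans_bijective`,
`ext_subsingleton_of_hom_subsingleton`). So on Ext(-, A) the map u acts as g, and on Ext(-, B) as f,
which gives the four conditions. -/

/-! ### Precomposition on Ext: direct summands in either variable. -/

section ExtPrecomp

open CategoryTheory CategoryTheory.Abelian CategoryTheory.Limits

universe w' v v' u'

variable {C : Type u} [Category.{v} C] [Abelian C] [HasExt.{w} C]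

lemma surjective_iff_and_injective_iff_of_comp_eq_comp {S T S' T' : Type*} {f : S → T}
    {g : S' → T'} {a : S → S'} {b : T → T'} (ha : Function.Bijective a) (hb : Function.Bijective b)
    (h : b ∘ f = g ∘ a) :
    (Function.Surjective f ↔ Function.Surjective g) ∧
      (Function.Injective f ↔ Function.Injective g) := by
  constructor
  · rw [← ha.surjective.of_comp_iff g, ← h]
    exact ⟨hb.surjective.comp, fun H => H.of_comp_left hb.injective⟩
  · rw [← Function.Injective.of_comp_iff' g ha, ← h, hb.injective.of_comp_iff]

/-- Precomposition `Ext^i(X, V) → Ext^i(X', V)` with a morphism `X' ⟶ X`. -/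
noncomputable abbrev extPrecomp {X' X : C} (u : X' ⟶ X) (V : C) (i : ℕ) :
    Ext X V i →+ Ext X' V i :=
  (Ext.mk₀ u).precomp V (zero_add i)

section Retract

variable {X' X V : C} (u : X' ⟶ X) {ι : Type*} [Fintype ι] {W : ι → C} (p : ∀ k, V ⟶ W k)
  (q : ∀ k, W k ⟶ V) (hpq : ∑ k, p k ≫ q k = 𝟙 V) (i : ℕ)

include hpq in
-- The hypothesis `hpq` says that V is a retract of the direct sum of the W k. This one form serves
-- direct summands (one index), binary sums (two indices) and finitely generated projective modules
-- (all W k equal to the ring).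
lemma ext_eq_sum_of_sum_eq_id (Z : C) (e : Ext Z V i) :
    e = ∑ k, (e.comp (Ext.mk₀ (p k)) (add_zero i)).comp (Ext.mk₀ (q k)) (add_zero i) := by
  have h : e.comp (Ext.mk₀ (∑ k, p k ≫ q k)) (add_zero i) = e := by rw [hpq, Ext.comp_mk₀_id]
  rw [Ext.mk₀_sum, Ext.comp_sum] at h
  refine h.symm.trans (Finset.sum_congr rfl fun k _ => ?_)
  simp

include hpq in
lemma extPrecomp_surjective_of_sum_eq_id
    (h : ∀ k, Function.Surjective (extPrecomp u (W k) i)) :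
    Function.Surjective (extPrecomp u V i) := by
  intro e
  choose d hd using fun k => h k (e.comp (Ext.mk₀ (p k)) (add_zero i))
  refine ⟨∑ k, (d k).comp (Ext.mk₀ (q k)) (add_zero i), ?_⟩
  rw [ext_eq_sum_of_sum_eq_id p q hpq i X' e, map_sum]
  refine Finset.sum_congr rfl fun k _ => ?_
  rw [← hd]
  simp

include hpq in
lemma extPrecomp_injective_of_sum_eq_id
    (h : ∀ k, Function.Injective (extPrecomp u (W k) i)) :
    Function.Injective (extPrecomp u V i) := by
  rw [injective_iff_map_eq_zero]
  intro e he
  rw [ext_eq_sum_of_sum_eq_id p q hpq i X e]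
  refine Finset.sum_eq_zero fun k _ => ?_
  have : e.comp (Ext.mk₀ (p k)) (add_zero i) = 0 := by
    apply (injective_iff_map_eq_zero _).1 (h k)
    have := congrArg (fun t => Ext.comp t (Ext.mk₀ (p k)) (add_zero i)) he
    simpa using this
  rw [this, Ext.zero_comp]

end Retract

section Bicone

variable {Q R Q' R' V : C} (b : BinaryBicone Q R) (b' : BinaryBicone Q' R')
  (hb : b.fst ≫ b.inl + b.snd ≫ b.inr = 𝟙 b.pt)
  (hb' : b'.fst ≫ b'.inl + b'.snd ≫ b'.inr = 𝟙 b'.pt)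

include hb in
lemma ext_eq_add_of_bicone {i : ℕ} (e : Ext b.pt V i) :
    e = (Ext.mk₀ b.fst).comp ((Ext.mk₀ b.inl).comp e (zero_add i)) (zero_add i) +
      (Ext.mk₀ b.snd).comp ((Ext.mk₀ b.inr).comp e (zero_add i)) (zero_add i) := by
  simp only [Ext.mk₀_comp_mk₀_assoc]
  rw [← Ext.add_comp, ← Ext.mk₀_add, hb, Ext.mk₀_id_comp]

include hb in
lemma extPostcomp_surjective_of_bicone {W : C} (v : V ⟶ W) (i : ℕ)
    (h₁ : Function.Surjective ((Ext.mk₀ v).postcomp Q (add_zero i)))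
    (h₂ : Function.Surjective ((Ext.mk₀ v).postcomp R (add_zero i))) :
    Function.Surjective ((Ext.mk₀ v).postcomp b.pt (add_zero i)) := by
  intro e
  obtain ⟨x, hx⟩ := h₁ ((Ext.mk₀ b.inl).comp e (zero_add i))
  obtain ⟨y, hy⟩ := h₂ ((Ext.mk₀ b.inr).comp e (zero_add i))
  refine ⟨(Ext.mk₀ b.fst).comp x (zero_add i) + (Ext.mk₀ b.snd).comp y (zero_add i), ?_⟩
  rw [ext_eq_add_of_bicone b hb e, ← hx, ← hy, map_add]
  simp

include hb in
lemma extPrecomp_inl_bijective (i : ℕ) [Subsingleton (Ext R V i)] :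
    Function.Bijective (extPrecomp b.inl V i) := by
  constructor
  · rw [injective_iff_map_eq_zero]
    intro e he
    rw [ext_eq_add_of_bicone b hb e, Subsingleton.elim ((Ext.mk₀ b.inr).comp e (zero_add i)) 0]
    change (Ext.mk₀ b.inl).comp e (zero_add i) = 0 at he
    simp only [he, Ext.comp_zero, add_zero]
  · intro x
    exact ⟨(Ext.mk₀ b.fst).comp x (zero_add i), by simp⟩

include hb in
lemma extPrecomp_inr_bijective (i : ℕ) [Subsingleton (Ext Q V i)] :
    Function.Bijective (extPrecomp b.inr V i) := by
  constructor
  · rw [injective_iff_map_eq_zero]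
    intro e he
    rw [ext_eq_add_of_bicone b hb e, Subsingleton.elim ((Ext.mk₀ b.inl).comp e (zero_add i)) 0]
    change (Ext.mk₀ b.inr).comp e (zero_add i) = 0 at he
    simp only [he, Ext.comp_zero, zero_add]
  · intro x
    exact ⟨(Ext.mk₀ b.snd).comp x (zero_add i), by simp⟩

variable {b b'} in
include hb hb' in
/-- If `Ext^i(-, V)` vanishes on the second summands, then a morphism of binary direct sums acts
on `Ext^i(-, V)` through the component between the first summands. -/
lemma extPrecomp_iff_of_inl {u : b'.pt ⟶ b.pt} {v : Q' ⟶ Q} {w : Q' ⟶ R}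
    (hu : b'.inl ≫ u = v ≫ b.inl + w ≫ b.inr) (i : ℕ)
    [Subsingleton (Ext R V i)] [Subsingleton (Ext R' V i)] :
    (Function.Surjective (extPrecomp u V i) ↔ Function.Surjective (extPrecomp v V i)) ∧
    (Function.Injective (extPrecomp u V i) ↔ Function.Injective (extPrecomp v V i)) := by
  have h : extPrecomp b'.inl V i ∘ extPrecomp u V i = extPrecomp v V i ∘ extPrecomp b.inl V i := by
    funext e
    change (Ext.mk₀ b'.inl).comp ((Ext.mk₀ u).comp e (zero_add i)) (zero_add i) =
      (Ext.mk₀ v).comp ((Ext.mk₀ b.inl).comp e (zero_add i)) (zero_add i)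
    rw [Ext.mk₀_comp_mk₀_assoc, hu, Ext.mk₀_add, Ext.add_comp, ← Ext.mk₀_comp_mk₀_assoc,
      ← Ext.mk₀_comp_mk₀_assoc, Subsingleton.elim ((Ext.mk₀ b.inr).comp e (zero_add i)) 0,
      Ext.comp_zero, add_zero]
  exact surjective_iff_and_injective_iff_of_comp_eq_comp
    (extPrecomp_inl_bijective b hb i) (extPrecomp_inl_bijective b' hb' i) h

variable {b b'} in
include hb hb' in
lemma extPrecomp_iff_of_inr {u : b'.pt ⟶ b.pt} {v : R' ⟶ R} {w : R' ⟶ Q}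
    (hu : b'.inr ≫ u = v ≫ b.inr + w ≫ b.inl) (i : ℕ)
    [Subsingleton (Ext Q V i)] [Subsingleton (Ext Q' V i)] :
    (Function.Surjective (extPrecomp u V i) ↔ Function.Surjective (extPrecomp v V i)) ∧
    (Function.Injective (extPrecomp u V i) ↔ Function.Injective (extPrecomp v V i)) := by
  have h : extPrecomp b'.inr V i ∘ extPrecomp u V i = extPrecomp v V i ∘ extPrecomp b.inr V i := by
    funext e
    change (Ext.mk₀ b'.inr).comp ((Ext.mk₀ u).comp e (zero_add i)) (zero_add i) =
      (Ext.mk₀ v).comp ((Ext.mk₀ b.inr).comp e (zero_add i)) (zero_add i)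
    rw [Ext.mk₀_comp_mk₀_assoc, hu, Ext.mk₀_add, Ext.add_comp, ← Ext.mk₀_comp_mk₀_assoc,
      ← Ext.mk₀_comp_mk₀_assoc, Subsingleton.elim ((Ext.mk₀ b.inl).comp e (zero_add i)) 0,
      Ext.comp_zero, add_zero]
  exact surjective_iff_and_injective_iff_of_comp_eq_comp
    (extPrecomp_inr_bijective b hb i) (extPrecomp_inr_bijective b' hb' i) h

end Bicone

/-! ### Dimension shifting along an exact functor preserving projective objects. -/

section Functor

variable {D : Type u'} [Category.{v'} D] [Abelian D] [HasExt.{w'} D] [EnoughProjectives C]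
  (T : C ⥤ D) [T.PreservesZeroMorphisms] [T.PreservesProjectiveObjects]
  (hT : ∀ S : ShortComplex C, S.ShortExact → (S.map T).ShortExact)

omit [HasExt.{w} C] in
lemma exists_shortExact_projective (X : C) :
    ∃ S : ShortComplex C, S.ShortExact ∧ Projective S.X₂ ∧ S.X₃ = X :=
  let P : ProjectivePresentation X := Classical.arbitrary _
  ⟨ShortComplex.mk _ _ (kernel.condition P.f), { exact := ShortComplex.exact_kernel P.f },
    P.projective, rfl⟩

omit [HasExt.{w} C] [EnoughProjectives C] in
include hT in
-- The middle term stays projective under T, so the connecting map onto Ext^(n+1) is surjective.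
-- This is the induction step of every dimension shift below.
lemma exists_extClass_comp_of_projective {S : ShortComplex C} (hS : S.ShortExact)
    [Projective S.X₂] (V : D) (n : ℕ) (e : Ext (T.obj S.X₃) V (n + 1)) :
    ∃ d : Ext (T.obj S.X₁) V n, (hT S hS).extClass.comp d (add_comm 1 n) = e := by
  have : Projective (S.map T).X₂ := T.projective_obj_of_projective inferInstance
  exact Ext.contravariant_sequence_exact₃ (hT S hS) V e (Ext.eq_zero_of_projective _) _

omit [HasExt.{w} C] in
include hT in
lemma ext_subsingleton_of_hom_subsingleton (V : D) (h : ∀ X, Subsingleton (T.obj X ⟶ V)) (n : ℕ)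
    (X : C) : Subsingleton (Ext (T.obj X) V n) := by
  induction n generalizing X with
  | zero => exact Ext.homEquiv₀.subsingleton
  | succ n ih =>
    obtain ⟨S, hS, hP, rfl⟩ := exists_shortExact_projective X
    refine subsingleton_of_forall_eq 0 fun e => ?_
    obtain ⟨d, rfl⟩ := exists_extClass_comp_of_projective T hT hS V n e
    rw [(ih S.X₁).elim d 0]
    exact Ext.comp_zero _ _ _ _ _

omit [HasExt.{w} C] in
include hT in
lemma extPostcomp_surjective_of_hom {V W : D} (v : V ⟶ W)
    (h : ∀ X, Function.Surjective fun s : T.obj X ⟶ V => s ≫ v) (n : ℕ) (X : C) :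
    Function.Surjective ((Ext.mk₀ v).postcomp (T.obj X) (add_zero n)) := by
  induction n generalizing X with
  | zero =>
    intro e
    obtain ⟨e, rfl⟩ := (Ext.mk₀_bijective _ _).2 e
    obtain ⟨s, rfl⟩ := h X e
    exact ⟨Ext.mk₀ s, by simp⟩
  | succ n ih =>
    obtain ⟨S, hS, hP, rfl⟩ := exists_shortExact_projective X
    intro e
    obtain ⟨d, rfl⟩ := exists_extClass_comp_of_projective T hT hS W n e
    obtain ⟨s, rfl⟩ := ih S.X₁ d
    exact ⟨(hT S hS).extClass.comp s (add_comm 1 n),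
      Ext.comp_assoc_of_third_deg_zero _ s (Ext.mk₀ v) _⟩

variable (F : C ⥤ D) [F.Additive] [PreservesFiniteLimits F] [PreservesFiniteColimits F]
  (τ : T ⟶ F)

/-- The map `Ext^n(X, V) → Ext^n(T X, F V)` given by an exact functor `F` and a natural
transformation `T ⟶ F`. -/
noncomputable def extMapOfNatTrans (X V : C) (n : ℕ) : Ext X V n →+ Ext (T.obj X) (F.obj V) n :=
  (extPrecomp (τ.app X) (F.obj V) n).comp (F.mapExtAddHom X V n)

omit [EnoughProjectives C] [T.PreservesZeroMorphisms] [T.PreservesProjectiveObjects] in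
lemma extMapOfNatTrans_apply (X V : C) (n : ℕ) (e : Ext X V n) :
    extMapOfNatTrans T F τ X V n e =
      (Ext.mk₀ (τ.app X)).comp (e.mapExactFunctor F) (zero_add n) := rfl

omit [EnoughProjectives C] [T.PreservesZeroMorphisms] [T.PreservesProjectiveObjects] in
lemma extMapOfNatTrans_precomp {X' X : C} (u : X' ⟶ X) (V : C) (n : ℕ) (e : Ext X V n) :
    extMapOfNatTrans T F τ X' V n (extPrecomp u V n e) =
      extPrecomp (T.map u) (F.obj V) n (extMapOfNatTrans T F τ X V n e) := by
  change extMapOfNatTrans T F τ X' V n ((Ext.mk₀ u).comp e (zero_add n)) =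
    (Ext.mk₀ (T.map u)).comp (extMapOfNatTrans T F τ X V n e) (zero_add n)
  simp [extMapOfNatTrans_apply, Ext.mapExactFunctor_comp, Ext.mapExactFunctor_mk₀]

include hT in
omit [EnoughProjectives C] [T.PreservesProjectiveObjects] in
lemma extMapOfNatTrans_extClass_comp {S : ShortComplex C} (hS : S.ShortExact) (V : C) (n : ℕ)
    (e : Ext S.X₁ V n) :
    extMapOfNatTrans T F τ S.X₃ V (n + 1) (hS.extClass.comp e (add_comm 1 n)) =
      (hT S hS).extClass.comp (extMapOfNatTrans T F τ S.X₁ V n e) (add_comm 1 n) := by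
  have := ShortComplex.ShortExact.extClass_naturality (hT S hS) (hS.map_of_exact F)
    (S.mapNatTrans τ)
  simp only [extMapOfNatTrans_apply, Ext.mapExactFunctor_comp, Ext.mapExactFunctor_extClass]
  have h₁ := Ext.comp_assoc_of_second_deg_zero (hT S hS).extClass (Ext.mk₀ (τ.app S.X₁))
    (e.mapExactFunctor F) (add_comm 1 n)
  refine Eq.trans ?_ h₁
  refine Eq.trans ?_ (congrArg (fun t => Ext.comp t (e.mapExactFunctor F) (add_comm 1 n)) this.symm)
  exact (Ext.comp_assoc _ _ _ _ _ (by lia)).symm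

include hT in
/-- If `Hom(X, V) → Hom(T X, F V)` is always bijective, where `T` is exact and preserves
projective objects, then so is `Ext^n(X, V) → Ext^n(T X, F V)`. -/
lemma extMapOfNatTrans_bijective (V : C)
    (h : ∀ X, Function.Bijective fun s : X ⟶ V => τ.app X ≫ F.map s) (n : ℕ) (X : C) :
    Function.Bijective (extMapOfNatTrans T F τ X V n) := by
  induction n generalizing X with
  | zero =>
    have : extMapOfNatTrans T F τ X V 0 ∘ Ext.mk₀ =
        Ext.mk₀ ∘ fun s : X ⟶ V => τ.app X ≫ F.map s := by
      funext s
      simp [extMapOfNatTrans_apply, Ext.mapExactFunctor_mk₀]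
    rw [← Function.Bijective.of_comp_iff _ (Ext.mk₀_bijective X V), this]
    exact (Ext.mk₀_bijective _ _).comp (h X)
  | succ n ih =>
    obtain ⟨S, hS, hP, rfl⟩ := exists_shortExact_projective X
    constructor
    · rw [injective_iff_map_eq_zero]
      intro e he
      obtain ⟨d, rfl⟩ := Ext.contravariant_sequence_exact₃ hS V e (Ext.eq_zero_of_projective _)
        (add_comm 1 n)
      rw [extMapOfNatTrans_extClass_comp T hT] at he
      -- The image of d comes from Ext^n at T S.X₂. By induction on S.X₂ it comes from Ext^n(S.X₂,
      -- V), and by injectivity at S.X₁ so does d itself; the connecting map then kills d. No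
      -- vanishing at S.X₂ is needed, so n = 0 is covered.
      obtain ⟨y, hy⟩ := Ext.contravariant_sequence_exact₁ (hT S hS) _ _ _ he
      obtain ⟨y, rfl⟩ := (ih S.X₂).2 y
      have := extMapOfNatTrans_precomp T F τ S.f V n y
      rw [(ih S.X₁).1 (hy.symm.trans this.symm)]
      simp
    · intro e
      obtain ⟨d, rfl⟩ := exists_extClass_comp_of_projective T hT hS _ n e
      obtain ⟨d, rfl⟩ := (ih S.X₁).2 d
      exact ⟨_, extMapOfNatTrans_extClass_comp T hT F τ hS V n d⟩

include hT in
lemma extPrecomp_map_iff {X' X : C} (u : X' ⟶ X) (V : C)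
    (h : ∀ X, Function.Bijective fun s : X ⟶ V => τ.app X ≫ F.map s) (n : ℕ) :
    (Function.Surjective (extPrecomp (T.map u) (F.obj V) n) ↔
      Function.Surjective (extPrecomp u V n)) ∧
    (Function.Injective (extPrecomp (T.map u) (F.obj V) n) ↔
      Function.Injective (extPrecomp u V n)) := by
  have hc : extPrecomp (T.map u) (F.obj V) n ∘ extMapOfNatTrans T F τ X V n =
      extMapOfNatTrans T F τ X' V n ∘ extPrecomp u V n :=
    funext fun e => (extMapOfNatTrans_precomp T F τ u V n e).symm
  obtain ⟨h₁, h₂⟩ := surjective_iff_and_injective_iff_of_comp_eq_comp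
    (extMapOfNatTrans_bijective T hT F τ V h n X) (extMapOfNatTrans_bijective T hT F τ V h n X')
    hc.symm
  exact ⟨h₁.symm, h₂.symm⟩

end Functor

/-! ### Ext equivalences and the long exact sequences in both variables. -/

section Comparison

variable {X' X : C} (u : X' ⟶ X)

/-- The map `Ext^i(X, V) → Ext^i(X', V)` is an epimorphism for `i = 0` and an isomorphism for
`i ≥ 1`. -/
def IsExtEquivalence (V : C) : Prop :=
  Function.Surjective (extPrecomp u V 0) ∧ ∀ i, 1 ≤ i → Function.Bijective (extPrecomp u V i)

lemma isExtEquivalence_iff (V : C) :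
    IsExtEquivalence u V ↔ (∀ i, Function.Surjective (extPrecomp u V i)) ∧
      ∀ i, Function.Injective (extPrecomp u V (i + 1)) := by
  constructor
  · rintro ⟨h₀, h⟩
    refine ⟨fun i => ?_, fun i => (h (i + 1) (by lia)).1⟩
    rcases i with _ | i
    exacts [h₀, (h (i + 1) (by lia)).2]
  · rintro ⟨h, h'⟩
    refine ⟨h 0, fun i hi => ⟨?_, h i⟩⟩
    obtain ⟨i, rfl⟩ := Nat.exists_eq_add_of_le' hi
    exact h' i

/-- Ext^(i+1)(S.X₃, V) sits between the cokernel of Ext^i(S.f, V) and the kernel of Ext^(i+1)(S.f,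
V). Injectivity is not required in degree 0, where the kernel is Hom(S.X₃, V). -/
lemma isExtEquivalence_iff_ext_subsingleton {S : ShortComplex C} (hS : S.ShortExact) (V : C) :
    IsExtEquivalence S.f V ↔ ∀ i, 1 ≤ i → Subsingleton (Ext S.X₃ V i) := by
  rw [isExtEquivalence_iff]
  constructor
  · rintro ⟨h, h'⟩ i hi
    obtain ⟨i, rfl⟩ := Nat.exists_eq_add_of_le' hi
    refine subsingleton_of_forall_eq 0 fun e => ?_
    have h₀ : (Ext.mk₀ S.g).comp e (zero_add _) = 0 := by
      apply (injective_iff_map_eq_zero _).1 (h' i)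
      change (Ext.mk₀ S.f).comp ((Ext.mk₀ S.g).comp e (zero_add _)) (zero_add _) = 0
      simp
    obtain ⟨d, rfl⟩ := Ext.contravariant_sequence_exact₃ hS V e h₀ (add_comm 1 i)
    obtain ⟨d, rfl⟩ := h i d
    simp
  · intro h
    constructor
    · intro i e
      exact Ext.contravariant_sequence_exact₁ hS V e (add_comm 1 i) ((h (i + 1) (by lia)).elim _ _)
    · intro i
      rw [injective_iff_map_eq_zero]
      intro e he
      obtain ⟨d, rfl⟩ := Ext.contravariant_sequence_exact₂ hS V e he
      rw [(h (i + 1) (by lia)).elim d 0, Ext.comp_zero]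

variable {S : ShortComplex C} (hS : S.ShortExact)
  (hX : ∀ i, Function.Surjective ((Ext.mk₀ S.g).postcomp X (add_zero i)))
  (hX' : ∀ i, Function.Surjective ((Ext.mk₀ S.g).postcomp X' (add_zero i)))
  (hsurj : ∀ i, Function.Surjective (extPrecomp u S.X₃ i) →
    Function.Surjective (extPrecomp u S.X₁ i))
  (hinj : ∀ i, Function.Injective (extPrecomp u S.X₃ i) →
    Function.Injective (extPrecomp u S.X₁ i))

include hS hX hX' hsurj hinj in
-- By `hX` and `hX'` the long exact sequences in the second variable break up into short ones,
-- compared by u. A five-lemma chase then applies, with `hsurj` and `hinj` controlling the term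
-- S.X₁.
lemma isExtEquivalence_iff_of_shortExact :
    IsExtEquivalence u S.X₂ ↔ IsExtEquivalence u S.X₃ := by
  simp only [isExtEquivalence_iff]
  constructor
  · rintro ⟨h, h'⟩
    have h₃ : ∀ i, Function.Surjective (extPrecomp u S.X₃ i) := by
      intro i e
      obtain ⟨d, rfl⟩ := hX' i e
      obtain ⟨d, rfl⟩ := h i d
      exact ⟨d.comp (Ext.mk₀ S.g) (add_zero i), by simp⟩
    refine ⟨h₃, fun i => ?_⟩
    rw [injective_iff_map_eq_zero]
    intro e he
    obtain ⟨d, rfl⟩ := hX (i + 1) e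
    obtain ⟨k, hk⟩ := Ext.covariant_sequence_exact₂ X' hS (extPrecomp u S.X₂ (i + 1) d)
      (by simpa using he)
    -- The class d may be changed by a class from S.X₁ so that u kills it; injectivity at S.X₂ shows
    -- that d itself comes from S.X₁, hence dies in S.X₃.
    obtain ⟨k, rfl⟩ := hsurj _ (h₃ _) k
    have : k.comp (Ext.mk₀ S.f) (add_zero _) = d := h' i (by rw [← hk]; simp)
    rw [← this]
    simp
  · rintro ⟨h, h'⟩
    constructor
    · intro i e
      obtain ⟨d, hd⟩ := h i (e.comp (Ext.mk₀ S.g) (add_zero i))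
      obtain ⟨d, rfl⟩ := hX i d
      obtain ⟨k, hk⟩ := Ext.covariant_sequence_exact₂ X' hS (e - extPrecomp u S.X₂ i d)
        (by
          have := sub_eq_zero.2 hd.symm
          rw [← this]
          rw [sub_eq_add_neg, Ext.add_comp, Ext.neg_comp, ← sub_eq_add_neg]
          simp)
      obtain ⟨k, rfl⟩ := hsurj _ (h _) k
      refine ⟨d + k.comp (Ext.mk₀ S.f) (add_zero _), ?_⟩
      rw [map_add]
      refine Eq.trans ?_ (add_sub_cancel (extPrecomp u S.X₂ i d) e)
      rw [← hk]
      simp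
    · intro i
      rw [injective_iff_map_eq_zero]
      intro e he
      have h₀ : e.comp (Ext.mk₀ S.g) (add_zero _) = 0 := by
        apply (injective_iff_map_eq_zero _).1 (h' i)
        have := congrArg (fun t => Ext.comp t (Ext.mk₀ S.g) (add_zero _)) he
        simpa using this
      obtain ⟨k, rfl⟩ := Ext.covariant_sequence_exact₂ X hS e h₀
      have hk : (extPrecomp u S.X₁ (i + 1) k).comp (Ext.mk₀ S.f) (add_zero _) = 0 := by
        simpa using he
      obtain ⟨d, hd⟩ := Ext.covariant_sequence_exact₁ X' hS _ hk (rfl : i + 1 = i + 1)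
      -- The connecting map is zero on d, because d lifts to S.X₂.
      obtain ⟨d, rfl⟩ := hX' i d
      have : extPrecomp u S.X₁ (i + 1) k = 0 := by
        rw [← hd]
        simp
      rw [(injective_iff_map_eq_zero _).1 (hinj _ (h' i)) k this, Ext.zero_comp]

end Comparison

end ExtPrecomp

/-! ### Functoriality and exactness of M ⊗_A -. -/

namespace BimodTensor

variable (B A : Type u) {M X X' X'' : Type u} [Ring B] [Ring A] [AddCommGroup M] [Module B M]
  [Module Aᵐᵒᵖ M] [SMulCommClass B Aᵐᵒᵖ M] [AddCommGroup X] [Module A X]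
  [AddCommGroup X'] [Module A X'] [AddCommGroup X''] [Module A X'']

@[elab_as_elim]
lemma induction_on {p : BimodTensor B A M X → Prop} (t : BimodTensor B A M X) (zero : p 0)
    (tmul : ∀ m x, p (tmul B A m x)) (add : ∀ s t, p s → p t → p (s + t)) : p t := by
  obtain ⟨t, rfl⟩ := (balancedRel B A M X).mkQ_surjective t
  induction t using TensorProduct.induction_on with
  | zero => rwa [map_zero]
  | tmul m x => exact tmul m x
  | add s t hs ht => rw [map_add]; exact add _ _ hs ht

/-- The additive map on `M ⊗_A X` given by a biadditive balanced map. -/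
noncomputable def lift {P : Type*} [AddCommGroup P] (h : M →+ X →+ P)
    (hbal : ∀ m (a : A) x, h (op a • m) x = h m (a • x)) : BimodTensor B A M X →+ P :=
  QuotientAddGroup.lift (balancedRel B A M X).toAddSubgroup
    (TensorProduct.liftAddHom h fun r m x => by simp) (by
      intro t ht
      change t ∈ AddSubgroup.closure _ at ht
      refine (AddSubgroup.closure_le (K := AddMonoidHom.ker _)).2 ?_ ht
      rintro _ ⟨m, a, x, rfl⟩
      change TensorProduct.liftAddHom h _ _ = 0
      rw [map_sub, sub_eq_zero]
      exact hbal m a x)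

@[simp]
lemma lift_tmul {P : Type*} [AddCommGroup P] (h : M →+ X →+ P)
    (hbal : ∀ m (a : A) x, h (op a • m) x = h m (a • x)) (m : M) (x : X) :
    lift B A h hbal (tmul B A m x) = h m x := rfl

variable (M) in
/-- The map `M ⊗_A X → M ⊗_A X'` induced by `u : X → X'`. -/
noncomputable def map (u : X →ₗ[A] X') : BimodTensor B A M X →ₗ[B] BimodTensor B A M X' where
  toFun := lift B A
    (AddMonoidHom.mk' (fun m => AddMonoidHom.mk' (fun x => tmul B A m (u x))
      fun x x' => by rw [map_add, tmul_add]) fun m m' => by ext x; simp [add_tmul])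
    fun m a x => by simp [op_smul_tmul]
  map_add' := map_add _
  map_smul' b t := by
    induction t using induction_on with
    | zero => simp
    | tmul m x => simp [smul_tmul']
    | add s t hs ht => simp only [smul_add, map_add, hs, ht]

@[simp]
lemma map_tmul (u : X →ₗ[A] X') (m : M) (x : X) :
    map B A M u (tmul B A m x) = tmul B A m (u x) := rfl

lemma map_id_apply (t : BimodTensor B A M X) : map B A M (LinearMap.id : X →ₗ[A] X) t = t := by
  induction t using induction_on with
  | zero => simp
  | tmul m x => rfl
  | add s t hs ht => rw [map_add, hs, ht]

lemma map_map (u : X →ₗ[A] X') (v : X' →ₗ[A] X'') (t : BimodTensor B A M X) :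
    map B A M v (map B A M u t) = map B A M (v ∘ₗ u) t := by
  induction t using induction_on with
  | zero => simp
  | tmul m x => rfl
  | add s t hs ht => simp only [map_add, hs, ht]

lemma map_zero_apply (t : BimodTensor B A M X) : map B A M (0 : X →ₗ[A] X') t = 0 := by
  induction t using induction_on with
  | zero => simp
  | tmul m x => simp [tmul_zero]
  | add s t hs ht => simp only [map_add, hs, ht, add_zero]

lemma map_surjective {u : X →ₗ[A] X'} (hu : Function.Surjective u) :
    Function.Surjective (map B A M u) := by
  intro t
  induction t using induction_on with
  | zero => exact ⟨0, map_zero _⟩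
  | tmul m x =>
    obtain ⟨x, rfl⟩ := hu x
    exact ⟨tmul B A m x, rfl⟩
  | add s t hs ht =>
    obtain ⟨s, rfl⟩ := hs
    obtain ⟨t, rfl⟩ := ht
    exact ⟨s + t, map_add _ _ _⟩

section Coordinates

variable (s : M →ₗ[Aᵐᵒᵖ] M →₀ Aᵐᵒᵖ)

/-- The coordinates of `m ⊗ x` are `s(m)_k x`, for a map `s` from `M` to a free module. -/
noncomputable def coord : BimodTensor B A M X →+ (M →₀ X) :=
  lift B A
    (AddMonoidHom.mk' (fun m => AddMonoidHom.mk'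
      (fun x => (s m).mapRange (fun c => unop c • x) (by simp))
      fun x x' => by ext; simp) fun m m' => by ext; simp [add_smul])
    fun m a x => by ext; simp [mul_smul]

lemma coord_tmul (m : M) (x : X) (k : M) :
    coord B A s (tmul B A m x) k = unop (s m k) • x := rfl

variable (M X) in
/-- The map sending `x` at the place `k` to `k ⊗ x`. -/
noncomputable def ofCoord : (M →₀ X) →+ BimodTensor B A M X :=
  Finsupp.liftAddHom fun k => AddMonoidHom.mk' (tmul B A k) (tmul_add B A k)

@[simp]
lemma ofCoord_single (k : M) (x : X) :
    ofCoord B A M X (Finsupp.single k x) = tmul B A k x := by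
  simp only [ofCoord, Finsupp.liftAddHom_apply_single, AddMonoidHom.mk'_apply]

lemma ofCoord_mapRange_smul (w : M →₀ Aᵐᵒᵖ) (x : X) :
    ofCoord B A M X (w.mapRange (fun c => unop c • x) (by simp)) =
      tmul B A (Finsupp.linearCombination Aᵐᵒᵖ id w) x := by
  induction w using Finsupp.induction_linear with
  | zero => simp [zero_tmul]
  | add v w hv hw =>
    rw [Finsupp.mapRange_add (fun a b => by simp [add_smul]), map_add, map_add, add_tmul, hv, hw]
  | single k c =>
    rw [Finsupp.mapRange_single, ofCoord_single, Finsupp.linearCombination_single]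
    exact (op_smul_tmul B A k (unop c) x).symm

lemma ofCoord_coord (hs : Finsupp.linearCombination Aᵐᵒᵖ id ∘ₗ s = LinearMap.id)
    (t : BimodTensor B A M X) : ofCoord B A M X (coord B A s t) = t := by
  induction t using induction_on with
  | zero => rw [map_zero, map_zero]
  | tmul m x =>
    exact (ofCoord_mapRange_smul B A (s m) x).trans
      (congrArg (fun m => tmul B A m x) (LinearMap.congr_fun hs m))
  | add s t hs ht => rw [map_add, map_add, hs, ht]

lemma coord_map (u : X →ₗ[A] X') (t : BimodTensor B A M X) :
    coord B A s (map B A M u t) = Finsupp.mapRange.addMonoidHom u.toAddMonoidHom (coord B A s t) := by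
  induction t using induction_on with
  | zero => simp
  | tmul m x => ext k; simp [coord_tmul]
  | add s t hs ht => simp only [map_add, hs, ht]

lemma map_ofCoord (u : X →ₗ[A] X') (w : M →₀ X) :
    map B A M u (ofCoord B A M X w) =
      ofCoord B A M X' (Finsupp.mapRange.addMonoidHom u.toAddMonoidHom w) := by
  induction w using Finsupp.induction_linear with
  | zero => simp
  | add s t hs ht => simp only [map_add, hs, ht]
  | single k x =>
    rw [Finsupp.mapRange.addMonoidHom_apply, Finsupp.mapRange_single, ofCoord_single,
      ofCoord_single, map_tmul]
    rfl

end Coordinates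

variable (M) in
lemma exists_coordinates [Module.Projective Aᵐᵒᵖ M] :
    ∃ s : M →ₗ[Aᵐᵒᵖ] M →₀ Aᵐᵒᵖ, Finsupp.linearCombination Aᵐᵒᵖ id ∘ₗ s = LinearMap.id :=
  (Module.projective_def' (R := Aᵐᵒᵖ) (P := M)).1 inferInstance

/-- A splitting s of the free cover of M makes M ⊗_A X a retract, naturally in X, of the group of
finitely supported functions M →₀ X. Injectivity, and likewise exactness, is inherited from there.
-/
lemma map_injective [Module.Projective Aᵐᵒᵖ M] {u : X →ₗ[A] X'} (hu : Function.Injective u) :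
    Function.Injective (map B A M u) := by
  obtain ⟨s, hs⟩ := exists_coordinates A M
  intro t t' h
  rw [← ofCoord_coord B A s hs t, ← ofCoord_coord B A s hs t']
  congr 1
  have := congrArg (coord B A s) h
  rw [coord_map, coord_map] at this
  exact Finsupp.mapRange_injective u (map_zero u) hu this

lemma map_exact [Module.Projective Aᵐᵒᵖ M] {u : X →ₗ[A] X'} {v : X' →ₗ[A] X''}
    (h : Function.Exact u v) : Function.Exact (map B A M u) (map B A M v) := by
  obtain ⟨s, hs⟩ := exists_coordinates A M
  intro t
  constructor
  · intro ht
    have ht' := congrArg (coord B A s) ht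
    rw [coord_map, map_zero] at ht'
    have hk : ∀ k, ∃ x, u x = coord B A s t k := fun k => (h _).1 (DFunLike.congr_fun ht' k)
    obtain ⟨w, hw⟩ : ∃ w : M →₀ X,
        Finsupp.mapRange.addMonoidHom u.toAddMonoidHom w = coord B A s t := by
      classical
      choose y hy using hk
      -- The chosen preimages are replaced by 0 where the coordinate vanishes, to keep the support
      -- finite.
      refine ⟨Finsupp.onFinset (coord B A s t).support
        (fun k => if coord B A s t k = 0 then 0 else y k) fun k => ?_, ?_⟩
      · contrapose!
        intro hk
        simp [Finsupp.notMem_support_iff.1 hk]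
      · ext k
        by_cases hk : coord B A s t k = 0
        · simp [hk]
        · simp [hk, hy]
    exact ⟨ofCoord B A M X w, by rw [map_ofCoord, hw, ofCoord_coord B A s hs]⟩
  · rintro ⟨t, rfl⟩
    rw [map_map, h.linearMap_comp_eq_zero, map_zero_apply]

end BimodTensor

/-! ### Modules induced from a column of Λ; one datum treats both columns. -/

section Column

open BimodTensor

/-- The data identifying `A ⊕ M`, with `M` a `B`-`A`-bimodule, with a column of a ring `Λ`:
surjective ring homomorphisms from `Λ` to the diagonal entries, the projection to the entry `M`,
and the inclusions of the entries of the column. -/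
structure ColumnDatum (Λ A B M : Type u) [Ring Λ] [Ring A] [Ring B] [AddCommGroup M] [Module B M]
    [Module Aᵐᵒᵖ M] where
  /-- the projection to the diagonal entry of the column -/
  α : Λ →+* A
  /-- the projection to the other diagonal entry -/
  β : Λ →+* B
  /-- the projection to the off-diagonal entry of the column -/
  μ : Λ →+ M
  μ_mul : ∀ s t, μ (s * t) = op (α t) • μ s + β s • μ t
  /-- the inclusion of the diagonal entry -/
  ι : A →+ Λ
  /-- the inclusion of the off-diagonal entry -/
  κ : M →+ Λ
  α_ι : ∀ a, α (ι a) = a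
  β_ι : ∀ a, β (ι a) = 0
  μ_ι : ∀ a, μ (ι a) = 0
  α_κ : ∀ m, α (κ m) = 0
  β_κ : ∀ m, β (κ m) = 0
  μ_κ : ∀ m, μ (κ m) = m
  mul_ι : ∀ s a, s * ι a = ι (α s * a) + κ (op a • μ s)
  mul_κ : ∀ s m, s * κ m = κ (β s • m)

variable {Λ A B M : Type u} [Ring Λ] [Ring A] [Ring B] [AddCommGroup M] [Module B M]
  [Module Aᵐᵒᵖ M] [SMulCommClass B Aᵐᵒᵖ M]

namespace ColumnDatum

section

omit [SMulCommClass B Aᵐᵒᵖ M]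

variable (c : ColumnDatum Λ A B M)

lemma μ_one : c.μ 1 = 0 := by
  simpa using c.μ_mul 1 1

lemma ι_mul_ι (a a' : A) : c.ι a * c.ι a' = c.ι (a * a') := by
  rw [c.mul_ι, c.α_ι, c.μ_ι, smul_zero, map_zero, add_zero]

lemma κ_mul_ι (m : M) (a : A) : c.κ m * c.ι a = c.κ (op a • m) := by
  rw [c.mul_ι, c.α_κ, c.μ_κ, zero_mul, map_zero, zero_add]

end

/-- The `Λ`-module `A ⊕ M` tensored with an `A`-module `X`: column vectors `(x; m ⊗ x')`. -/
def Col (_c : ColumnDatum Λ A B M) (X : Type u) [AddCommGroup X] [Module A X] : Type u :=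
  X × BimodTensor B A M X

namespace Col

variable (c : ColumnDatum Λ A B M) (X : Type u) [AddCommGroup X] [Module A X]
  {X' X'' : Type u} [AddCommGroup X'] [Module A X'] [AddCommGroup X''] [Module A X'']

instance : AddCommGroup (c.Col X) := inferInstanceAs (AddCommGroup (X × BimodTensor B A M X))

variable {X}

/-- The column vector `(x; t)`. -/
def mk (x : X) (t : BimodTensor B A M X) : c.Col X := ((x, t) : X × BimodTensor B A M X)

instance : SMul Λ (c.Col X) where
  smul s v := mk c (c.α s • v.1) (tmul B A (c.μ s) v.1 + c.β s • v.2)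

@[simp] lemma mk_fst (x : X) (t : BimodTensor B A M X) : (mk c x t).1 = x := rfl
@[simp] lemma mk_snd (x : X) (t : BimodTensor B A M X) : (mk c x t).2 = t := rfl
@[simp] lemma add_fst (v w : c.Col X) : (v + w).1 = v.1 + w.1 := rfl
@[simp] lemma add_snd (v w : c.Col X) : (v + w).2 = v.2 + w.2 := rfl
@[simp] lemma zero_fst : (0 : c.Col X).1 = 0 := rfl
@[simp] lemma zero_snd : (0 : c.Col X).2 = 0 := rfl
@[simp] lemma smul_fst (s : Λ) (v : c.Col X) : (s • v).1 = c.α s • v.1 := rfl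
@[simp] lemma smul_snd (s : Λ) (v : c.Col X) :
    (s • v).2 = tmul B A (c.μ s) v.1 + c.β s • v.2 := rfl

@[ext] lemma ext {v w : c.Col X} (h₁ : v.1 = w.1) (h₂ : v.2 = w.2) : v = w := Prod.ext h₁ h₂

instance : Module Λ (c.Col X) where
  one_smul v := by ext <;> simp [c.μ_one, zero_tmul]
  mul_smul s t v := by
    ext
    · simp [mul_smul]
    · simp [mul_smul, c.μ_mul, add_tmul, op_smul_tmul, BimodTensor.smul_tmul', add_assoc]
  smul_zero s := by ext <;> simp [tmul_zero]
  smul_add s v w := by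
    ext
    · simp
    · simp [tmul_add, add_add_add_comm]
  add_smul s t v := by
    ext
    · simp [add_smul]
    · simp [add_smul, add_tmul, add_add_add_comm]
  zero_smul v := by ext <;> simp [zero_tmul]

lemma ι_smul_mk (a : A) (x : X) : c.ι a • mk c x 0 = mk c (a • x) 0 := by
  ext <;> simp [c.α_ι, c.μ_ι, zero_tmul]

lemma κ_smul_mk (m : M) (x : X) : c.κ m • mk c x 0 = mk c 0 (tmul B A m x) := by
  ext <;> simp [c.α_κ, c.μ_κ]

/-- The vectors (x; 0) generate, as `κ m` sends (x; 0) to (0; m ⊗ x). -/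
lemma hom_ext {Z : Type*} [AddCommGroup Z] [Module Λ Z] {h h' : c.Col X →ₗ[Λ] Z}
    (H : ∀ x, h (mk c x 0) = h' (mk c x 0)) : h = h' := by
  have h₂ : ∀ t, h (mk c 0 t) = h' (mk c 0 t) := by
    intro t
    induction t using BimodTensor.induction_on with
    | zero => exact (map_zero h).trans (map_zero h').symm
    | tmul m x => rw [← κ_smul_mk, map_smul, map_smul, H]
    | add s t hs ht =>
      have : mk c (0 : X) (s + t) = mk c 0 s + mk c 0 t := by ext <;> simp
      rw [this, map_add, map_add, hs, ht]
  ext v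
  have : v = mk c v.1 0 + mk c 0 v.2 := by ext <;> simp
  rw [this, map_add, map_add, H, h₂]

/-- The universal property: linear maps from `Col X` correspond to maps `X → Z` compatible with
the action of the diagonal entries. -/
noncomputable def lift {Z : Type*} [AddCommGroup Z] [Module Λ Z] (k : X →+ Z)
    (hk : ∀ (a : A) x, k (a • x) = c.ι a • k x) : c.Col X →ₗ[Λ] Z :=
  let L : BimodTensor B A M X →+ Z := BimodTensor.lift B A
    (AddMonoidHom.mk' (fun m => AddMonoidHom.mk' (fun x => c.κ m • k x)
      fun x x' => by rw [map_add, smul_add]) fun m m' => by ext x; simp [add_smul])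
    fun m a x => by
      change c.κ (op a • m) • k x = c.κ m • k (a • x)
      rw [hk, ← mul_smul, c.κ_mul_ι]
  { toFun := fun v => k v.1 + L v.2
    map_add' := fun v w => by
      rw [add_fst, add_snd, map_add, map_add, add_add_add_comm]
    map_smul' := fun s v => by
      have hL : ∀ t, L (c.β s • t) = s • L t := by
        intro t
        induction t using BimodTensor.induction_on with
        | zero => simp
        | tmul m x =>
          rw [BimodTensor.smul_tmul']
          change c.κ (c.β s • m) • k x = s • c.κ m • k x
          rw [← mul_smul, c.mul_κ]
        | add t t' ht ht' => rw [smul_add, map_add, map_add, ht, ht', smul_add]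
      -- The case a = 1 of `hk` says that the idempotent `ι 1` fixes k x, so s acts on it as `s * ι
      -- 1 = ι (α s) + κ (μ s)`.
      have hk' : s • k v.1 = k (c.α s • v.1) + c.κ (c.μ s) • k v.1 := by
        have h₁ := hk 1 v.1
        rw [one_smul] at h₁
        rw [hk]
        conv_lhs => rw [h₁]
        rw [← mul_smul, c.mul_ι, add_smul, mul_one, op_one, one_smul]
      rw [RingHom.id_apply, smul_add, hk', smul_fst, smul_snd, map_add, hL, add_assoc]
      rfl }

lemma lift_mk {Z : Type*} [AddCommGroup Z] [Module Λ Z] (k : X →+ Z)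
    (hk : ∀ (a : A) x, k (a • x) = c.ι a • k x) (x : X) : lift c k hk (mk c x 0) = k x := by
  change k x + _ = k x
  rw [mk_snd, map_zero, add_zero]

/-- The map `Col X → Col X'` induced by `u : X → X'`. -/
noncomputable def map (u : X →ₗ[A] X') : c.Col X →ₗ[Λ] c.Col X' where
  toFun v := mk c (u v.1) (BimodTensor.map B A M u v.2)
  map_add' v w := by ext <;> simp
  map_smul' s v := by ext <;> simp

@[simp] lemma map_fst (u : X →ₗ[A] X') (v : c.Col X) : (map c u v).1 = u v.1 := rfl
@[simp] lemma map_snd (u : X →ₗ[A] X') (v : c.Col X) :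
    (map c u v).2 = BimodTensor.map B A M u v.2 := rfl

lemma map_exact [Module.Projective Aᵐᵒᵖ M] {u : X →ₗ[A] X'} {v : X' →ₗ[A] X''}
    (h : Function.Exact u v) : Function.Exact (map c u) (map c v) := by
  intro w
  constructor
  · intro hw
    obtain ⟨x, hx⟩ := (h w.1).1 (congrArg Prod.fst hw)
    obtain ⟨t, ht⟩ := (BimodTensor.map_exact B A h w.2).1 (congrArg Prod.snd hw)
    exact ⟨mk c x t, Prod.ext hx ht⟩
  · rintro ⟨w, rfl⟩
    exact Prod.ext (h.apply_apply_eq_zero w.1)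
      ((BimodTensor.map_exact B A h).apply_apply_eq_zero w.2)

lemma map_injective [Module.Projective Aᵐᵒᵖ M] {u : X →ₗ[A] X'} (h : Function.Injective u) :
    Function.Injective (map c u) := fun _ _ hw =>
  Prod.ext (h (congrArg Prod.fst hw)) (BimodTensor.map_injective B A h (congrArg Prod.snd hw))

lemma map_surjective {u : X →ₗ[A] X'} (h : Function.Surjective u) :
    Function.Surjective (map c u) := fun w => by
  obtain ⟨x, hx⟩ := h w.1
  obtain ⟨t, ht⟩ := BimodTensor.map_surjective B A (M := M) h w.2
  exact ⟨mk c x t, Prod.ext hx ht⟩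

variable (X) in
-- A section of A^(X) → X is transported to a section of any surjection p from a free Λ-module,
-- through chosen preimages z x of (x; 0). Letting a act on z x as `ι a` gives the compatibility
-- needed by `lift`, even if `ι 1` does not fix z x.
lemma projective [Module.Projective A X] : Module.Projective Λ (c.Col X) := by
  refine Module.Projective.of_lifting_property'' fun p hp => ?_
  obtain ⟨s, hs⟩ := (Module.projective_def' (R := A) (P := X)).1 inferInstance
  choose z hz using fun x : X => hp (mk c x 0)
  let k' : (X →₀ A) →+ (c.Col X →₀ Λ) := Finsupp.liftAddHom fun x =>
    AddMonoidHom.mk' (fun a => c.ι a • z x) fun a a' => by rw [map_add, add_smul]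
  have hk'₁ : ∀ x a, k' (Finsupp.single x a) = c.ι a • z x := fun x a => by
    simp only [k', Finsupp.liftAddHom_apply_single, AddMonoidHom.mk'_apply]
  have hk' : ∀ (a : A) w, k' (a • w) = c.ι a • k' w := by
    intro a w
    induction w using Finsupp.induction_linear with
    | zero => simp
    | add v w hv hw => rw [smul_add, map_add, map_add, smul_add, hv, hw]
    | single x b =>
      rw [Finsupp.smul_single, hk'₁, hk'₁, ← mul_smul, c.ι_mul_ι, smul_eq_mul]
  have hpk : ∀ w, p (k' w) = mk c (Finsupp.linearCombination A id w) 0 := by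
    intro w
    induction w using Finsupp.induction_linear with
    | zero => simp; rfl
    | add v w hv hw =>
      rw [map_add, map_add, hv, hw, map_add]
      ext <;> simp
    | single x b =>
      rw [hk'₁, map_smul, hz, ι_smul_mk, Finsupp.linearCombination_single, id]
  refine ⟨lift c (k'.comp s.toAddMonoidHom) fun a x => ?_, hom_ext c fun x => ?_⟩
  · change k' (s (a • x)) = c.ι a • k' (s x)
    rw [map_smul, hk']
  · rw [LinearMap.comp_apply, lift_mk]
    change p (k' (s x)) = _
    rw [hpk]
    exact congrArg (fun x => mk c x 0) (LinearMap.congr_fun hs x)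

end Col

open CategoryTheory CategoryTheory.Abelian CategoryTheory.Limits

variable (c : ColumnDatum Λ A B M)

/-- The functor `X ↦ Col X`. -/
noncomputable def colFunctor : ModuleCat.{u} A ⥤ ModuleCat.{u} Λ where
  obj X := ModuleCat.of Λ (c.Col X)
  map u := ModuleCat.ofHom (Col.map c u.hom)
  map_id X := by
    ext v
    exact Prod.ext rfl (BimodTensor.map_id_apply B A v.2)
  map_comp u v := by
    ext w
    exact Prod.ext rfl (BimodTensor.map_map B A u.hom v.hom w.2).symm

instance : c.colFunctor.PreservesZeroMorphisms where
  map_zero X Y := by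
    ext w
    exact Prod.ext rfl (BimodTensor.map_zero_apply B A w.2)

instance : c.colFunctor.PreservesProjectiveObjects where
  projective_obj {X} hX := by
    have : Module.Projective A X := (IsProjective.iff_projective X).2 hX
    have := Col.projective c X
    exact (IsProjective.iff_projective (c.Col X)).1 this

lemma colFunctor_map_shortExact [Module.Projective Aᵐᵒᵖ M] (S : ShortComplex (ModuleCat.{u} A))
    (hS : S.ShortExact) : (S.map c.colFunctor).ShortExact :=
  ModuleCat.shortComplex_shortExact _
    (Col.map_exact c ((ShortComplex.ShortExact.moduleCat_exact_iff_function_exact S).1 hS.exact))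
    (Col.map_injective c hS.moduleCat_injective_f)
    (Col.map_surjective c hS.moduleCat_surjective_g)

/-- Restriction of scalars leaves the underlying maps unchanged, and exactness depends only on
these. -/
instance {R S : Type u} [Ring R] [Ring S] (f : R →+* S) :
    PreservesFiniteLimits (ModuleCat.restrictScalars.{u} f) := by
  have := ((ModuleCat.restrictScalars.{u} f).exact_tfae.out 1 3).1 fun S h => by
    rw [ShortComplex.ShortExact.moduleCat_exact_iff_function_exact] at h ⊢
    exact h
  exact this.1

/-- The projection from `Col X` to `X`, viewed as a `Λ`-module. -/
noncomputable def colProj : c.colFunctor ⟶ ModuleCat.restrictScalars c.α where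
  app X := ModuleCat.ofHom (X := c.Col X) (Y := (ModuleCat.restrictScalars c.α).obj X)
    { toFun := fun v => v.1
      map_add' := fun _ _ => rfl
      map_smul' := fun _ _ => rfl }

lemma colProj_comp_bijective (X V : ModuleCat.{u} A) :
    Function.Bijective fun s : X ⟶ V =>
      c.colProj.app X ≫ (ModuleCat.restrictScalars c.α).map s := by
  constructor
  · intro s s' h
    ext x
    exact LinearMap.congr_fun (congrArg ModuleCat.Hom.hom h) (Col.mk c x 0)
  · intro h
    let h' : c.Col X →ₗ[Λ] (ModuleCat.restrictScalars c.α).obj V := h.hom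
    refine ⟨ModuleCat.ofHom
      { toFun := fun x => (h' (Col.mk c x 0) : V)
        map_add' := fun x x' => ?_
        map_smul' := fun a x => ?_ }, ?_⟩
    · have : Col.mk c (x + x') 0 = Col.mk c x 0 + Col.mk c x' 0 := by ext <;> simp
      rw [this, map_add]
      rfl
    · rw [← Col.ι_smul_mk, map_smul]
      change c.α (c.ι a) • (h' (Col.mk c x 0) : V) = _
      rw [c.α_ι]
      rfl
    · apply ModuleCat.hom_ext
      exact Col.hom_ext c fun x => rfl

/-- The idempotent `ι 1` fixes the generators (x; 0) and acts as zero on a module inflated along β.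
-/
lemma colFunctor_hom_subsingleton (X : ModuleCat.{u} A) (W : ModuleCat.{u} B) :
    Subsingleton (c.colFunctor.obj X ⟶ (ModuleCat.restrictScalars c.β).obj W) := by
  refine subsingleton_of_forall_eq 0 fun h => ModuleCat.hom_ext ?_
  let h' : c.Col X →ₗ[Λ] (ModuleCat.restrictScalars c.β).obj W := h.hom
  refine Col.hom_ext c fun x => ?_
  have : Col.mk c x 0 = c.ι 1 • Col.mk c x 0 := by rw [Col.ι_smul_mk, one_smul]
  change h' (Col.mk c x 0) = 0
  rw [this, map_smul]
  change c.β (c.ι 1) • (h' (Col.mk c x 0) : W) = 0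
  rw [c.β_ι, zero_smul]

end ColumnDatum

end Column

/-! ### Lifting maps from columns, products of modules, finitely generated projective coefficients.
-/

section Generalities

open CategoryTheory CategoryTheory.Abelian CategoryTheory.Limits

universe v

/-- A map out of a column is determined by its values on (x; 0), so the section σ needs to commute
only with the diagonal entries `ι a`, not with all of Λ. -/
lemma ColumnDatum.colFunctor_hom_surjective {Λ A B M : Type u} [Ring Λ] [Ring A] [Ring B]
    [AddCommGroup M] [Module B M] [Module Aᵐᵒᵖ M] [SMulCommClass B Aᵐᵒᵖ M]
    (c : ColumnDatum Λ A B M) {V W : ModuleCat.{u} Λ} (v : V ⟶ W) (σ : W →+ V)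
    (hv : ∀ w, v (σ w) = w) (hσ : ∀ a w, σ (c.ι a • w) = c.ι a • σ w) (X : ModuleCat.{u} A) :
    Function.Surjective fun s : c.colFunctor.obj X ⟶ V => s ≫ v := by
  intro h
  let h' : c.Col X →ₗ[Λ] W := h.hom
  let k : X →+ V := σ.comp (AddMonoidHom.mk' (fun x => h' (Col.mk c x 0)) fun x x' => by
    rw [← map_add]
    congr 1)
  have hk : ∀ (a : A) x, k (a • x) = c.ι a • k x := fun a x => by
    change σ (h' (Col.mk c (a • x) 0)) = c.ι a • σ (h' (Col.mk c x 0))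
    rw [← Col.ι_smul_mk, map_smul, hσ]
  refine ⟨ModuleCat.ofHom (Col.lift c k hk), ModuleCat.hom_ext (Col.hom_ext c fun x => ?_)⟩
  change v (Col.lift c k hk (Col.mk c x 0)) = h' (Col.mk c x 0)
  rw [Col.lift_mk]
  exact hv _

variable {C : Type u} [Category.{v} C] [Abelian C] [HasExt.{w} C]

lemma extPrecomp_bicone_iff {X' X : C} (u : X' ⟶ X) {Q R : C} (b : BinaryBicone Q R)
    (hb : b.fst ≫ b.inl + b.snd ≫ b.inr = 𝟙 b.pt) (i : ℕ) :
    (Function.Surjective (extPrecomp u b.pt i) ↔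
      Function.Surjective (extPrecomp u Q i) ∧ Function.Surjective (extPrecomp u R i)) ∧
    (Function.Injective (extPrecomp u b.pt i) ↔
      Function.Injective (extPrecomp u Q i) ∧ Function.Injective (extPrecomp u R i)) := by
  let W : Bool → C := fun k => bif k then Q else R
  let p : ∀ k, b.pt ⟶ W k := fun k => match k with | true => b.fst | false => b.snd
  let q : ∀ k, W k ⟶ b.pt := fun k => match k with | true => b.inl | false => b.inr
  have hpq : ∑ k, p k ≫ q k = 𝟙 b.pt := by
    rw [Fintype.sum_bool]
    exact hb
  have hQ : ∑ _k : Unit, b.inl ≫ b.fst = 𝟙 Q := by simp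
  have hR : ∑ _k : Unit, b.inr ≫ b.snd = 𝟙 R := by simp
  refine ⟨⟨fun h => ⟨?_, ?_⟩, fun h => ?_⟩, ⟨fun h => ⟨?_, ?_⟩, fun h => ?_⟩⟩
  · exact extPrecomp_surjective_of_sum_eq_id u _ _ hQ i fun _ => h
  · exact extPrecomp_surjective_of_sum_eq_id u _ _ hR i fun _ => h
  · exact extPrecomp_surjective_of_sum_eq_id u p q hpq i
      fun k => match k with | true => h.1 | false => h.2
  · exact extPrecomp_injective_of_sum_eq_id u _ _ hQ i fun _ => h
  · exact extPrecomp_injective_of_sum_eq_id u _ _ hR i fun _ => h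
  · exact extPrecomp_injective_of_sum_eq_id u p q hpq i
      fun k => match k with | true => h.1 | false => h.2

/-- The product of two modules as a binary bicone. -/
abbrev prodBicone {R : Type u} [Ring R] (P Q : Type u) [AddCommGroup P] [Module R P]
    [AddCommGroup Q] [Module R Q] : BinaryBicone (ModuleCat.of R P) (ModuleCat.of R Q) where
  pt := ModuleCat.of R (P × Q)
  fst := ModuleCat.ofHom (LinearMap.fst R P Q)
  snd := ModuleCat.ofHom (LinearMap.snd R P Q)
  inl := ModuleCat.ofHom (LinearMap.inl R P Q)
  inr := ModuleCat.ofHom (LinearMap.inr R P Q)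
  inl_fst := rfl
  inl_snd := rfl
  inr_fst := rfl
  inr_snd := rfl

lemma prodBicone_total {R : Type u} [Ring R] (P Q : Type u) [AddCommGroup P] [Module R P]
    [AddCommGroup Q] [Module R Q] :
    (prodBicone P Q : BinaryBicone (ModuleCat.of R P) _).fst ≫ (prodBicone P Q).inl +
      (prodBicone P Q).snd ≫ (prodBicone P Q).inr = 𝟙 (prodBicone P Q).pt := by
  refine ModuleCat.hom_ext (LinearMap.ext fun x => ?_)
  exact Prod.ext (add_zero x.1) (zero_add x.2)

section DualBasis

variable {R P : Type u} [Ring R] [AddCommGroup P] [Module R P]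

variable (R P) in
-- This is the dual basis lemma, in the form used for retracts above.
lemma exists_sum_comp_eq_id [Module.Finite R P] [Module.Projective R P] :
    ∃ (n : ℕ) (p : Fin n → (ModuleCat.of R P ⟶ ModuleCat.of R R))
      (q : Fin n → (ModuleCat.of R R ⟶ ModuleCat.of R P)),
      ∑ k, p k ≫ q k = 𝟙 (ModuleCat.of R P) := by
  obtain ⟨n, f, hf⟩ := Module.Finite.exists_fin' R P
  obtain ⟨s, hs⟩ := Module.projective_lifting_property f LinearMap.id hf
  refine ⟨n, fun k => ModuleCat.ofHom (LinearMap.proj k ∘ₗ s),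
    fun k => ModuleCat.ofHom (LinearMap.toSpanSingleton R P (f (Pi.single k 1))), ?_⟩
  apply ModuleCat.hom_ext
  rw [ModuleCat.hom_sum]
  ext x
  have hx : f (s x) = x := LinearMap.congr_fun hs x
  conv_rhs => rw [ModuleCat.hom_id, LinearMap.id_apply, ← hx, ← Finset.univ_sum_single (s x)]
  rw [LinearMap.sum_apply, map_sum]
  refine Finset.sum_congr rfl fun k _ => ?_
  change s x k • f (Pi.single k 1) = _
  rw [← map_smul, ← Pi.single_smul, smul_eq_mul, mul_one]

lemma extPrecomp_surjective_of_finite_projective [Module.Finite R P] [Module.Projective R P]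
    {X' X : ModuleCat.{u} R} (u : X' ⟶ X) (i : ℕ)
    (h : Function.Surjective (extPrecomp u (ModuleCat.of R R) i)) :
    Function.Surjective (extPrecomp u (ModuleCat.of R P) i) := by
  obtain ⟨n, p, q, hpq⟩ := exists_sum_comp_eq_id R P
  exact extPrecomp_surjective_of_sum_eq_id u p q hpq i fun _ => h

lemma extPrecomp_injective_of_finite_projective [Module.Finite R P] [Module.Projective R P]
    {X' X : ModuleCat.{u} R} (u : X' ⟶ X) (i : ℕ)
    (h : Function.Injective (extPrecomp u (ModuleCat.of R R) i)) :
    Function.Injective (extPrecomp u (ModuleCat.of R P) i) := by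
  obtain ⟨n, p, q, hpq⟩ := exists_sum_comp_eq_id R P
  exact extPrecomp_injective_of_sum_eq_id u p q hpq i fun _ => h

lemma isExtEquivalence_ofHom_iff {X X' : Type u} [AddCommGroup X] [Module R X] [AddCommGroup X']
    [Module R X'] (g : X' →ₗ[R] X) :
    IsExtEquivalence (ModuleCat.ofHom g) (ModuleCat.of R P) ↔
      Function.Surjective (fun h : X →ₗ[R] P => h ∘ₗ g) ∧
        ∀ i, 1 ≤ i → Function.Bijective (modExtMap g P i) := by
  have hb : ∀ Z : Type u, ∀ [AddCommGroup Z] [Module R Z], Function.Bijective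
      fun h : Z →ₗ[R] P => Ext.mk₀ (ModuleCat.ofHom h) := fun Z _ _ =>
    (Ext.mk₀_bijective _ _).comp (ModuleCat.homEquiv (M := ModuleCat.of R Z)
      (N := ModuleCat.of R P)).symm.bijective
  have := (surjective_iff_and_injective_iff_of_comp_eq_comp
    (f := fun h : X →ₗ[R] P => h ∘ₗ g)
    (g := extPrecomp (ModuleCat.ofHom g) (ModuleCat.of R P) 0) (hb X) (hb X') (by
      funext h
      simp)).1
  rw [this]
  rfl

end DualBasis

end Generalities

/-! ### The two columns of Λ and its filtration by off-diagonal and diagonal entries. -/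

namespace MoritaRing

open CategoryTheory CategoryTheory.Abelian CategoryTheory.Limits

open BimodTensor

variable {A B M N : Type u} [Ring A] [Ring B]
  [AddCommGroup M] [Module B M] [Module Aᵐᵒᵖ M] [SMulCommClass B Aᵐᵒᵖ M]
  [AddCommGroup N] [Module A N] [Module Bᵐᵒᵖ N] [SMulCommClass A Bᵐᵒᵖ N]
  (D : MoritaDatum A B M N)

section

variable (hMN : Subsingleton (BimodTensor B A M N)) (hNM : Subsingleton (BimodTensor A B N M))

include hNM in
lemma ψ_eq_zero (t : BimodTensor A B N M) : D.ψ t = 0 := by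
  rw [hNM.elim t 0, map_zero]

include hMN in
lemma φ_eq_zero (t : BimodTensor B A M N) : D.φ t = 0 := by
  rw [hMN.elim t 0, map_zero]

/-- The first column of a Morita ring with `M ⊗_A N = 0 = N ⊗_B M`. -/
def leftColumn : ColumnDatum (MoritaRing D) A B M where
  α := { toFun := a, map_one' := rfl, map_zero' := rfl, map_add' := fun _ _ => rfl,
         map_mul' := fun s t => by rw [mul_a, ψ_eq_zero D hNM, add_zero] }
  β := { toFun := b, map_one' := rfl, map_zero' := rfl, map_add' := fun _ _ => rfl,
         map_mul' := fun s t => by rw [mul_b, φ_eq_zero D hMN, add_zero] }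
  μ := { toFun := m, map_zero' := rfl, map_add' := fun _ _ => rfl }
  μ_mul s t := rfl
  ι := AddMonoidHom.mk' (fun a => ⟨a, 0, 0, 0⟩) fun a a' => by ext <;> simp
  κ := AddMonoidHom.mk' (fun m => ⟨0, 0, m, 0⟩) fun m m' => by ext <;> simp
  α_ι _ := rfl
  β_ι _ := rfl
  μ_ι _ := rfl
  α_κ _ := rfl
  β_κ _ := rfl
  μ_κ _ := rfl
  mul_ι s a := by ext <;> simp [tmul_zero]
  mul_κ s m := by ext <;> simp [tmul_zero, ψ_eq_zero D hNM]

/-- The second column of a Morita ring with `M ⊗_A N = 0 = N ⊗_B M`. -/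
def rightColumn : ColumnDatum (MoritaRing D) B A N where
  α := (leftColumn D hMN hNM).β
  β := (leftColumn D hMN hNM).α
  μ := { toFun := n, map_zero' := rfl, map_add' := fun _ _ => rfl }
  μ_mul s t := add_comm _ _
  ι := AddMonoidHom.mk' (fun b => ⟨0, 0, 0, b⟩) fun a a' => by ext <;> simp
  κ := AddMonoidHom.mk' (fun n => ⟨0, n, 0, 0⟩) fun m m' => by ext <;> simp
  α_ι _ := rfl
  β_ι _ := rfl
  μ_ι _ := rfl
  α_κ _ := rfl
  β_κ _ := rfl
  μ_κ _ := rfl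
  mul_ι s a := by
    ext
    · simp [tmul_zero]
    · simp
    · simp
    · simp [tmul_zero, leftColumn]
  mul_κ s m := by
    ext
    · simp [tmul_zero]
    · simp [leftColumn]
    · simp
    · simp [φ_eq_zero D hMN]

/-- The `A`-module `V` as a module over the Morita ring. -/
noncomputable abbrev inflA (V : Type u) [AddCommGroup V] [Module A V] :
    ModuleCat.{u} (MoritaRing D) :=
  (ModuleCat.restrictScalars (leftColumn D hMN hNM).α).obj (ModuleCat.of A V)

/-- The `B`-module `V` as a module over the Morita ring. -/
noncomputable abbrev inflB (V : Type u) [AddCommGroup V] [Module B V] :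
    ModuleCat.{u} (MoritaRing D) :=
  (ModuleCat.restrictScalars (leftColumn D hMN hNM).β).obj (ModuleCat.of B V)

/-- The inclusion of the off-diagonal entries. -/
def offDiag : inflA D hMN hNM N × inflB D hMN hNM M →ₗ[MoritaRing D] MoritaRing D where
  toFun v := ⟨0, v.1, v.2, 0⟩
  map_add' v w := by ext <;> simp <;> rfl
  map_smul' s v := by
    ext
    · simp [ψ_eq_zero D hNM]
    · simp; rfl
    · simp; rfl
    · simp [φ_eq_zero D hMN]

/-- The projection to the diagonal entries. -/
def diag : MoritaRing D →ₗ[MoritaRing D] inflA D hMN hNM A × inflB D hMN hNM B where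
  toFun s := (s.a, s.b)
  map_add' v w := rfl
  map_smul' s t := by
    refine Prod.ext ?_ ?_
    · exact map_mul (leftColumn D hMN hNM).α s t
    · exact map_mul (leftColumn D hMN hNM).β s t

/-- The exact sequence `0 → N ⊕ M → Λ → A ⊕ B → 0` of left `Λ`-modules. -/
noncomputable abbrev diagShortComplex : ShortComplex (ModuleCat.{u} (MoritaRing D)) :=
  ModuleCat.shortComplexOfCompEqZero (offDiag D hMN hNM) (diag D hMN hNM) rfl

lemma diagShortComplex_shortExact : (diagShortComplex D hMN hNM).ShortExact := by
  refine ModuleCat.shortComplex_shortExact _ ?_ ?_ ?_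
  · intro s
    constructor
    · intro hs
      refine ⟨(s.n, s.m), MoritaRing.ext ?_ rfl rfl ?_⟩
      · exact (congrArg Prod.fst hs).symm
      · exact (congrArg Prod.snd hs).symm
    · rintro ⟨v, rfl⟩
      rfl
  · intro v w h
    exact Prod.ext (congrArg MoritaRing.n h) (congrArg MoritaRing.m h)
  · rintro ⟨a, b⟩
    exact ⟨⟨a, 0, 0, b⟩, rfl⟩

/-- The inclusion of the diagonal matrices. -/
noncomputable def ofDiag : inflA D hMN hNM A × inflB D hMN hNM B →+ MoritaRing D :=
  AddMonoidHom.mk' (fun v => ⟨v.1, 0, 0, v.2⟩) fun v w => by ext <;> simp <;> rfl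

/-- Inclusion of diagonal matrices is not Λ-linear in general, but left multiplication by (a, 0; 0,
0) preserves them. That is enough to lift maps from a column, and dimension shifting extends this to
all degrees. -/
lemma diag_postcomp_left_surjective [Module.Projective Aᵐᵒᵖ M] (X : ModuleCat.{u} A) (i : ℕ) :
    Function.Surjective ((Ext.mk₀ (diagShortComplex D hMN hNM).g).postcomp
      ((leftColumn D hMN hNM).colFunctor.obj X) (add_zero i)) := by
  refine extPostcomp_surjective_of_hom _
    (leftColumn D hMN hNM).colFunctor_map_shortExact _
    ((leftColumn D hMN hNM).colFunctor_hom_surjective _ (ofDiag D hMN hNM) ?_ ?_) i X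
  · intro w
    rfl
  · intro a w
    let w₁ : A := w.1
    let w₂ : B := w.2
    have h : (leftColumn D hMN hNM).ι a • w = ((a • (w.1 : A) : A), (0 : B)) :=
      Prod.ext rfl (zero_smul B (w.2 : B))
    rw [h]
    ext
    · change a * w₁ = a * w₁ + _
      rw [ψ_eq_zero D hNM, add_zero]
    · change (0 : N) = a • 0 + op _ • 0
      rw [smul_zero, smul_zero, add_zero]
    · change (0 : M) = op _ • 0 + (0 : B) • 0
      rw [smul_zero, smul_zero, add_zero]
    · change (0 : B) = 0 * w₂ + _
      rw [φ_eq_zero D hMN, add_zero, zero_mul]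

lemma diag_postcomp_right_surjective [Module.Projective Bᵐᵒᵖ N] (Y : ModuleCat.{u} B) (i : ℕ) :
    Function.Surjective ((Ext.mk₀ (diagShortComplex D hMN hNM).g).postcomp
      ((rightColumn D hMN hNM).colFunctor.obj Y) (add_zero i)) := by
  refine extPostcomp_surjective_of_hom _
    (rightColumn D hMN hNM).colFunctor_map_shortExact _
    ((rightColumn D hMN hNM).colFunctor_hom_surjective _ (ofDiag D hMN hNM) ?_ ?_) i Y
  · intro w
    rfl
  · intro b w
    let w₁ : A := w.1
    let w₂ : B := w.2
    have h : (rightColumn D hMN hNM).ι b • w = ((0 : A), (b • (w.2 : B) : B)) :=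
      Prod.ext (zero_smul A (w.1 : A)) rfl
    rw [h]
    ext
    · change (0 : A) = 0 * w₁ + _
      rw [ψ_eq_zero D hNM, add_zero, zero_mul]
    · change (0 : N) = (0 : A) • 0 + op _ • 0
      rw [smul_zero, smul_zero, add_zero]
    · change (0 : M) = op _ • 0 + b • 0
      rw [smul_zero, smul_zero, add_zero]
    · change b * w₂ = b * w₂ + _
      rw [φ_eq_zero D hMN, add_zero]

end

end MoritaRing

/-! ### The presentation of (X; Y) by columns. -/

section Offdiagonal

open BimodTensor

variable {Λ A B M N : Type u} [Ring Λ] [Ring A] [Ring B]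
  [AddCommGroup M] [Module B M] [Module Aᵐᵒᵖ M] [SMulCommClass B Aᵐᵒᵖ M]
  [AddCommGroup N] [Module A N] [Module Bᵐᵒᵖ N] [SMulCommClass A Bᵐᵒᵖ N]

/-- For fixed y the map (m, n) ↦ m ⊗ (n ⊗ y) is biadditive and balanced, hence factors through M ⊗_A
N = 0. -/
lemma BimodTensor.subsingleton_tmul_tmul (hMN : Subsingleton (BimodTensor B A M N)) (Y : Type u)
    [AddCommGroup Y] [Module B Y] :
    Subsingleton (BimodTensor B A M (BimodTensor A B N Y)) := by
  refine subsingleton_of_forall_eq 0 fun t => ?_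
  induction t using BimodTensor.induction_on with
  | zero => rfl
  | add s t hs ht => rw [hs, ht, add_zero]
  | tmul m t =>
    induction t using BimodTensor.induction_on with
    | zero => exact tmul_zero B A m
    | add s t hs ht => rw [tmul_add, hs, ht, add_zero]
    | tmul n y =>
      exact eq_zero_of_subsingleton B A
        (AddMonoidHom.mk' (fun m => AddMonoidHom.mk' (fun n => tmul B A m (tmul A B n y))
          fun n n' => by rw [add_tmul, tmul_add])
          fun m m' => by ext n; simp [add_tmul])
        (fun m a n => by simp [op_smul_tmul, ← smul_tmul']) m n

/-- The map `(t; s) ↦ (0; t)` from the first column tensored with `N ⊗_B Y` to the second column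
tensored with `Y`. -/
def ColumnDatum.Col.shift (c : ColumnDatum Λ A B M) (c' : ColumnDatum Λ B A N)
    (h : c'.β = c.α) (Y : Type u) [AddCommGroup Y] [Module B Y] :
    c.Col (BimodTensor A B N Y) →ₗ[Λ] c'.Col Y where
  toFun v := Col.mk c' 0 v.1
  map_add' v w := by ext <;> simp
  map_smul' s v := by ext <;> simp [h, tmul_zero]

end Offdiagonal

namespace MoritaRing

open CategoryTheory CategoryTheory.Abelian CategoryTheory.Limits

open BimodTensor

variable {A B M N : Type u} [Ring A] [Ring B]
  [AddCommGroup M] [Module B M] [Module Aᵐᵒᵖ M] [SMulCommClass B Aᵐᵒᵖ M]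
  [AddCommGroup N] [Module A N] [Module Bᵐᵒᵖ N] [SMulCommClass A Bᵐᵒᵖ N]
  (D : MoritaDatum A B M N)
  (hMN : Subsingleton (BimodTensor B A M N)) (hNM : Subsingleton (BimodTensor A B N M))
  {X Y : Type u} [AddCommGroup X] [Module A X] [AddCommGroup Y] [Module B Y]
  (f : BimodTensor B A M X →ₗ[B] Y) (g : BimodTensor A B N Y →ₗ[A] X)

open ColumnDatum

lemma map_tmul_eq_zero (h : Subsingleton (BimodTensor B A M N)) (m : M)
    (t : BimodTensor A B N Y) : f (tmul B A m (g t)) = 0 := by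
  induction t using BimodTensor.induction_on with
  | zero => rw [map_zero, tmul_zero, map_zero]
  | tmul n y => exact comp_eq_zero_of_subsingleton h f g m n y
  | add s t hs ht => rw [map_add, tmul_add, map_add, hs, ht, add_zero]

/-- The map from the first column tensored with `X` to the module `(X; Y)`. -/
noncomputable def leftToCarrier : (leftColumn D hMN hNM).Col X →ₗ[MoritaRing D]
    (MoritaQuad.ofMaps D hMN hNM f g).Carrier where
  toFun v := ((v.1, f v.2) : X × Y)
  map_add' v w := by
    refine Prod.ext rfl ?_
    exact map_add f _ _
  map_smul' s v := by
    refine Prod.ext ?_ ?_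
    · change s.a • v.1 = s.a • v.1 + g (tmul A B s.n (f v.2))
      rw [map_tmul_eq_zero g f hNM, add_zero]
    · change f (tmul B A s.m v.1 + s.b • v.2) = f (tmul B A s.m v.1) + s.b • f v.2
      rw [map_add, map_smul]

/-- The map from the second column tensored with `Y` to the module `(X; Y)`. -/
noncomputable def rightToCarrier : (rightColumn D hMN hNM).Col Y →ₗ[MoritaRing D]
    (MoritaQuad.ofMaps D hMN hNM f g).Carrier where
  toFun v := ((g v.2, v.1) : X × Y)
  map_add' v w := by
    refine Prod.ext ?_ rfl
    exact map_add g _ _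
  map_smul' s v := by
    refine Prod.ext ?_ ?_
    · change g (tmul A B s.n v.1 + s.a • v.2) = s.a • g v.2 + g (tmul A B s.n v.1)
      rw [map_add, map_smul, add_comm]
    · change s.b • v.1 = f (tmul B A s.m (g v.2)) + s.b • v.1
      rw [map_tmul_eq_zero f g hMN, zero_add]

/-- The map between sums of columns with cokernel `(X; Y)`. -/
noncomputable def presentationMap :
    (leftColumn D hMN hNM).Col (BimodTensor A B N Y) ×
      (rightColumn D hMN hNM).Col (BimodTensor B A M X) →ₗ[MoritaRing D]
    (leftColumn D hMN hNM).Col X × (rightColumn D hMN hNM).Col Y :=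
  LinearMap.coprod
    (LinearMap.prod (Col.map _ g) (-Col.shift (leftColumn D hMN hNM) (rightColumn D hMN hNM) rfl Y))
    (LinearMap.prod (-Col.shift (rightColumn D hMN hNM) (leftColumn D hMN hNM) rfl X)
      (Col.map _ f))

lemma presentationMap_apply_fst (v : (leftColumn D hMN hNM).Col (BimodTensor A B N Y))
    (w : (rightColumn D hMN hNM).Col (BimodTensor B A M X)) :
    (presentationMap D hMN hNM f g (v, w)).1 = Col.mk _ (g v.1) (-w.1) := by
  have := BimodTensor.subsingleton_tmul_tmul hMN Y
  refine Prod.ext ?_ ?_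
  · change g v.1 + -0 = g v.1
    rw [neg_zero, add_zero]
  · change BimodTensor.map B A M g v.2 + -w.1 = -w.1
    rw [Subsingleton.elim v.2 0, map_zero, zero_add]

lemma presentationMap_apply_snd (v : (leftColumn D hMN hNM).Col (BimodTensor A B N Y))
    (w : (rightColumn D hMN hNM).Col (BimodTensor B A M X)) :
    (presentationMap D hMN hNM f g (v, w)).2 = Col.mk _ (f w.1) (-v.1) := by
  have := BimodTensor.subsingleton_tmul_tmul hNM X
  refine Prod.ext ?_ ?_
  · change -0 + f w.1 = f w.1
    rw [neg_zero, zero_add]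
  · change -v.1 + BimodTensor.map A B N f w.2 = -v.1
    rw [Subsingleton.elim w.2 0, map_zero, add_zero]

lemma presentation_exact : Function.Exact (presentationMap D hMN hNM f g)
    (LinearMap.coprod (leftToCarrier D hMN hNM f g) (rightToCarrier D hMN hNM f g)) := by
  intro z
  constructor
  · intro hz
    have h₁ : z.1.1 + g z.2.2 = 0 := congrArg Prod.fst hz
    have h₂ : f z.1.2 + z.2.1 = 0 := congrArg Prod.snd hz
    -- The shifts enter `presentationMap` with a minus sign, so the preimage is forced to be minus
    -- the tensor entries of z; the relations h₁ and h₂ recover the remaining entries.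
    refine ⟨(Col.mk _ (-z.2.2) 0, Col.mk _ (-z.1.2) 0), Prod.ext ?_ ?_⟩
    · rw [presentationMap_apply_fst]
      refine Prod.ext ?_ (neg_neg _)
      change g (-z.2.2) = z.1.1
      rw [map_neg, eq_neg_of_add_eq_zero_left h₁]
    · rw [presentationMap_apply_snd]
      refine Prod.ext ?_ (neg_neg _)
      change f (-z.1.2) = z.2.1
      rw [map_neg, eq_neg_of_add_eq_zero_right h₂]
  · rintro ⟨⟨v, w⟩, rfl⟩
    have h : ∀ z, LinearMap.coprod (leftToCarrier D hMN hNM f g)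
        (rightToCarrier D hMN hNM f g) z = ((z.1.1 + g z.2.2, f z.1.2 + z.2.1) : X × Y) :=
      fun _ => rfl
    rw [h, presentationMap_apply_fst, presentationMap_apply_snd]
    refine Prod.ext ?_ ?_
    · change g v.1 + g (-v.1) = 0
      rw [map_neg, add_neg_cancel]
    · change f (-w.1) + f w.1 = 0
      rw [map_neg, neg_add_cancel]

/-- The shifts already detect the first entries v.1 and w.1, and the second entries lie in zero
groups. -/
lemma presentationMap_injective : Function.Injective (presentationMap D hMN hNM f g) := by
  rw [injective_iff_map_eq_zero]
  rintro ⟨v, w⟩ h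
  have := BimodTensor.subsingleton_tmul_tmul hMN Y
  have := BimodTensor.subsingleton_tmul_tmul hNM X
  have h₁ := congrArg Prod.fst h
  have h₂ := congrArg Prod.snd h
  rw [presentationMap_apply_fst] at h₁
  rw [presentationMap_apply_snd] at h₂
  have hw : -w.1 = 0 := congrArg Prod.snd h₁
  have hv : -v.1 = 0 := congrArg Prod.snd h₂
  exact Prod.ext (Prod.ext (neg_eq_zero.1 hv) (Subsingleton.elim v.2 0))
    (Prod.ext (neg_eq_zero.1 hw) (Subsingleton.elim w.2 0))

lemma presentation_surjective : Function.Surjective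
    (LinearMap.coprod (leftToCarrier D hMN hNM f g) (rightToCarrier D hMN hNM f g)) := by
  intro z
  refine ⟨(Col.mk _ z.1 0, Col.mk _ z.2 0), Prod.ext ?_ ?_⟩
  · change z.1 + g 0 = z.1
    rw [map_zero, add_zero]
  · change f 0 + z.2 = z.2
    rw [map_zero, zero_add]

/-- The presentation of the module `(X; Y)` by sums of columns. -/
noncomputable abbrev presentation : ShortComplex (ModuleCat.{u} (MoritaRing D)) :=
  ModuleCat.shortComplexOfCompEqZero (presentationMap D hMN hNM f g)
    (LinearMap.coprod (leftToCarrier D hMN hNM f g) (rightToCarrier D hMN hNM f g))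
    (presentation_exact D hMN hNM f g).linearMap_comp_eq_zero

lemma presentation_shortExact : (presentation D hMN hNM f g).ShortExact :=
  ModuleCat.shortComplex_shortExact _ (presentation_exact D hMN hNM f g)
    (presentationMap_injective D hMN hNM f g) (presentation_surjective D hMN hNM f g)

lemma isSemiGorensteinProjective_iff :
    IsSemiGorensteinProjective (MoritaRing D) (MoritaQuad.ofMaps D hMN hNM f g).Carrier ↔
      IsExtEquivalence (ModuleCat.ofHom (presentationMap D hMN hNM f g))
        (ModuleCat.of (MoritaRing D) (MoritaRing D)) :=
  (isExtEquivalence_iff_ext_subsingleton (presentation_shortExact D hMN hNM f g) _).symm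

variable [Module.Projective Aᵐᵒᵖ M] [Module.Projective Bᵐᵒᵖ N]

/-- Ext into an inflated A-module vanishes on the second columns, so only the component T_A(g)
survives, and on first columns these Ext groups are those over A. -/
lemma extPrecomp_presentationMap_inflA_iff (V : Type u) [AddCommGroup V] [Module A V] (i : ℕ) :
    (Function.Surjective (extPrecomp (ModuleCat.ofHom (presentationMap D hMN hNM f g))
        (inflA D hMN hNM V) i) ↔
      Function.Surjective (extPrecomp (ModuleCat.ofHom g) (ModuleCat.of A V) i)) ∧
    (Function.Injective (extPrecomp (ModuleCat.ofHom (presentationMap D hMN hNM f g))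
        (inflA D hMN hNM V) i) ↔
      Function.Injective (extPrecomp (ModuleCat.ofHom g) (ModuleCat.of A V) i)) := by
  have hs : ∀ Z : ModuleCat.{u} B,
      Subsingleton (Ext (ModuleCat.of _ ((rightColumn D hMN hNM).Col Z)) (inflA D hMN hNM V) i) :=
    ext_subsingleton_of_hom_subsingleton _ (rightColumn D hMN hNM).colFunctor_map_shortExact _
      (fun Z => (rightColumn D hMN hNM).colFunctor_hom_subsingleton Z (ModuleCat.of A V)) i
  have h₁ := extPrecomp_map_iff _ (leftColumn D hMN hNM).colFunctor_map_shortExact _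
    (leftColumn D hMN hNM).colProj (ModuleCat.ofHom g) (ModuleCat.of A V)
    (fun X => (leftColumn D hMN hNM).colProj_comp_bijective X (ModuleCat.of A V)) i
  have := hs (ModuleCat.of B Y)
  have := hs (ModuleCat.of B (BimodTensor B A M X))
  have h₂ := extPrecomp_iff_of_inl (V := inflA D hMN hNM V)
    (prodBicone_total ((leftColumn D hMN hNM).Col X) ((rightColumn D hMN hNM).Col Y))
    (prodBicone_total ((leftColumn D hMN hNM).Col (BimodTensor A B N Y))
      ((rightColumn D hMN hNM).Col (BimodTensor B A M X)))
    (u := ModuleCat.ofHom (presentationMap D hMN hNM f g))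
    (v := (leftColumn D hMN hNM).colFunctor.map (ModuleCat.ofHom g))
    (w := ModuleCat.ofHom (-Col.shift (leftColumn D hMN hNM) (rightColumn D hMN hNM) rfl Y)) (by
      exact ModuleCat.hom_ext ((LinearMap.coprod_inl _ _).trans (by
        ext v : 1; exact Prod.ext (add_zero _).symm (zero_add _).symm))) i
  exact ⟨h₂.1.trans h₁.1, h₂.2.trans h₁.2⟩

lemma extPrecomp_presentationMap_inflB_iff (V : Type u) [AddCommGroup V] [Module B V] (i : ℕ) :
    (Function.Surjective (extPrecomp (ModuleCat.ofHom (presentationMap D hMN hNM f g))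
        (inflB D hMN hNM V) i) ↔
      Function.Surjective (extPrecomp (ModuleCat.ofHom f) (ModuleCat.of B V) i)) ∧
    (Function.Injective (extPrecomp (ModuleCat.ofHom (presentationMap D hMN hNM f g))
        (inflB D hMN hNM V) i) ↔
      Function.Injective (extPrecomp (ModuleCat.ofHom f) (ModuleCat.of B V) i)) := by
  have hs : ∀ Z : ModuleCat.{u} A,
      Subsingleton (Ext (ModuleCat.of _ ((leftColumn D hMN hNM).Col Z)) (inflB D hMN hNM V) i) :=
    ext_subsingleton_of_hom_subsingleton _ (leftColumn D hMN hNM).colFunctor_map_shortExact _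
      (fun Z => (leftColumn D hMN hNM).colFunctor_hom_subsingleton Z (ModuleCat.of B V)) i
  have h₁ := extPrecomp_map_iff _ (rightColumn D hMN hNM).colFunctor_map_shortExact _
    (rightColumn D hMN hNM).colProj (ModuleCat.ofHom f) (ModuleCat.of B V)
    (fun X => (rightColumn D hMN hNM).colProj_comp_bijective X (ModuleCat.of B V)) i
  have := hs (ModuleCat.of A X)
  have := hs (ModuleCat.of A (BimodTensor A B N Y))
  have h₂ := extPrecomp_iff_of_inr (V := inflB D hMN hNM V)
    (prodBicone_total ((leftColumn D hMN hNM).Col X) ((rightColumn D hMN hNM).Col Y))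
    (prodBicone_total ((leftColumn D hMN hNM).Col (BimodTensor A B N Y))
      ((rightColumn D hMN hNM).Col (BimodTensor B A M X)))
    (u := ModuleCat.ofHom (presentationMap D hMN hNM f g))
    (v := (rightColumn D hMN hNM).colFunctor.map (ModuleCat.ofHom f))
    (w := ModuleCat.ofHom (-Col.shift (rightColumn D hMN hNM) (leftColumn D hMN hNM) rfl X)) (by
      exact ModuleCat.hom_ext ((LinearMap.coprod_inr _ _).trans (by
        ext v : 1; exact Prod.ext (zero_add _).symm (add_zero _).symm))) i
  exact ⟨h₂.1.trans h₁.1, h₂.2.trans h₁.2⟩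

lemma extPrecomp_presentationMap_prod_iff (V W : Type u) [AddCommGroup V] [Module A V]
    [AddCommGroup W] [Module B W] (i : ℕ) :
    (Function.Surjective (extPrecomp (ModuleCat.ofHom (presentationMap D hMN hNM f g))
        (ModuleCat.of (MoritaRing D) (inflA D hMN hNM V × inflB D hMN hNM W)) i) ↔
      Function.Surjective (extPrecomp (ModuleCat.ofHom g) (ModuleCat.of A V) i) ∧
      Function.Surjective (extPrecomp (ModuleCat.ofHom f) (ModuleCat.of B W) i)) ∧
    (Function.Injective (extPrecomp (ModuleCat.ofHom (presentationMap D hMN hNM f g))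
        (ModuleCat.of (MoritaRing D) (inflA D hMN hNM V × inflB D hMN hNM W)) i) ↔
      Function.Injective (extPrecomp (ModuleCat.ofHom g) (ModuleCat.of A V) i) ∧
      Function.Injective (extPrecomp (ModuleCat.ofHom f) (ModuleCat.of B W) i)) := by
  have h := extPrecomp_bicone_iff (ModuleCat.ofHom (presentationMap D hMN hNM f g))
    _ (prodBicone_total (inflA D hMN hNM V) (inflB D hMN hNM W)) i
  have hA := extPrecomp_presentationMap_inflA_iff D hMN hNM f g V i
  have hB := extPrecomp_presentationMap_inflB_iff D hMN hNM f g W i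
  exact ⟨h.1.trans (and_congr hA.1 hB.1), h.2.trans (and_congr hA.2 hB.2)⟩

/-! ### Passage from Λ to its diagonal entries, and the theorem. -/

variable [Module.Finite A N] [Module.Projective A N] [Module.Finite B M] [Module.Projective B M]

lemma isExtEquivalence_presentationMap_iff :
    IsExtEquivalence (ModuleCat.ofHom (presentationMap D hMN hNM f g))
        (ModuleCat.of (MoritaRing D) (MoritaRing D)) ↔
      IsExtEquivalence (ModuleCat.ofHom g) (ModuleCat.of A A) ∧
      IsExtEquivalence (ModuleCat.ofHom f) (ModuleCat.of B B) := by
  have hA := extPrecomp_presentationMap_prod_iff D hMN hNM f g A B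
  have hN := extPrecomp_presentationMap_prod_iff D hMN hNM f g N M
  have h := isExtEquivalence_iff_of_shortExact
    (ModuleCat.ofHom (presentationMap D hMN hNM f g)) (diagShortComplex_shortExact D hMN hNM)
    (fun i => extPostcomp_surjective_of_bicone _ (prodBicone_total _ _) _ i
      (diag_postcomp_left_surjective D hMN hNM (ModuleCat.of A X) i)
      (diag_postcomp_right_surjective D hMN hNM (ModuleCat.of B Y) i))
    (fun i => extPostcomp_surjective_of_bicone _ (prodBicone_total _ _) _ i
      (diag_postcomp_left_surjective D hMN hNM (ModuleCat.of A (BimodTensor A B N Y)) i)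
      (diag_postcomp_right_surjective D hMN hNM (ModuleCat.of B (BimodTensor B A M X)) i))
    (fun i hi => (hN i).1.2 (((hA i).1.1 hi).imp
      (extPrecomp_surjective_of_finite_projective _ i)
      (extPrecomp_surjective_of_finite_projective _ i)))
    (fun i hi => (hN i).2.2 (((hA i).2.1 hi).imp
      (extPrecomp_injective_of_finite_projective _ i)
      (extPrecomp_injective_of_finite_projective _ i)))
  refine h.trans ?_
  simp only [isExtEquivalence_iff]
  constructor
  · rintro ⟨h₁, h₂⟩
    exact ⟨⟨fun i => ((hA i).1.1 (h₁ i)).1, fun i => ((hA (i + 1)).2.1 (h₂ i)).1⟩,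
      ⟨fun i => ((hA i).1.1 (h₁ i)).2, fun i => ((hA (i + 1)).2.1 (h₂ i)).2⟩⟩
  · rintro ⟨⟨h₁, h₂⟩, h₃, h₄⟩
    exact ⟨fun i => (hA i).1.2 ⟨h₁ i, h₃ i⟩, fun i => (hA (i + 1)).2.2 ⟨h₂ i, h₄ i⟩⟩

end MoritaRing

theorem theorem1p3 {R : Type w} [CommRing R] [IsArtinianRing R]
    {A B M N : Type u} [Ring A] [Algebra R A] [Module.Finite R A]
    [Ring B] [Algebra R B] [Module.Finite R B]
    -- `M` is a `B`-`A`-bimodule, finitely generated over `R`, with `R` acting centrally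
    [AddCommGroup M] [Module B M] [Module Aᵐᵒᵖ M] [SMulCommClass B Aᵐᵒᵖ M]
    [Module R M] [IsScalarTower R B M] [IsScalarTower R Aᵐᵒᵖ M] [Module.Finite R M]
    -- `N` is an `A`-`B`-bimodule, finitely generated over `R`, with `R` acting centrally
    [AddCommGroup N] [Module A N] [Module Bᵐᵒᵖ N] [SMulCommClass A Bᵐᵒᵖ N]
    [Module R N] [IsScalarTower R A N] [IsScalarTower R Bᵐᵒᵖ N] [Module.Finite R N]
    (D : MoritaDatum A B M N)
    (hMN : Subsingleton (BimodTensor B A M N)) (hNM : Subsingleton (BimodTensor A B N M))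
    (hBM : Module.Projective B M) (hAN : Module.Projective A N)
    (hMA : Module.Projective Aᵐᵒᵖ M) (hNB : Module.Projective Bᵐᵒᵖ N)
    {X Y : Type u} [AddCommGroup X] [Module A X] [Module.Finite A X]
    [AddCommGroup Y] [Module B Y] [Module.Finite B Y]
    (f : BimodTensor B A M X →ₗ[B] Y) (g : BimodTensor A B N Y →ₗ[A] X) :
    IsSemiGorensteinProjective (MoritaRing D) (MoritaQuad.ofMaps D hMN hNM f g).Carrier ↔
      Function.Surjective (fun h : X →ₗ[A] A => h ∘ₗ g) ∧
      (∀ i : ℕ, 1 ≤ i → Function.Bijective (modExtMap g A i)) ∧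
      Function.Surjective (fun h : Y →ₗ[B] B => h ∘ₗ f) ∧
      (∀ i : ℕ, 1 ≤ i → Function.Bijective (modExtMap f B i)) := by
  -- Finite generation over R gives finite generation over A and B; with projectivity this makes N
  -- and M direct summands of finite free left modules.
  have : Module.Finite A N := Module.Finite.of_restrictScalars_finite R A N
  have : Module.Finite B M := Module.Finite.of_restrictScalars_finite R B M
  rw [MoritaRing.isSemiGorensteinProjective_iff, MoritaRing.isExtEquivalence_presentationMap_iff,
    isExtEquivalence_ofHom_iff, isExtEquivalence_ofHom_iff, and_assoc]
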